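/- Let $\Gamma$ be a locally compact, second countable, Hausdorff groupoid with unit space $X$, range and source maps $r,s:\Gamma\to X$, and a left Haar system. Let $A$ be a separable $C_0(X)$-algebra: a separable $C^*$-algebra with a nondegenerate $^*$-homomorphism $\theta$ from $C_0(X)$ into the centre of the multiplier algebra $M(A)$, so that $\theta(C_0(X))A=A$; write $fa=\theta(f)a$. For $x\in X$ let $I_x=\{f\in C_0(X): f(x)=0\}$, let $A_x=A/(I_xA)$, and let $a_x$ be the image of $a\in A$ in $A_x$. Let $A^\sharp=\bigsqcup_{x\in X}A_x$ have the topology with basic open sets $U(a,\epsilon)=\{b_x\in A_x: x\in U,\ \|b_x-a_x\|<\epsilon\}$, for $U\subset X$ open, $a\in A$ and $\epsilon>0$. Let $Iso(A^\sharp)$ be the groupoid with unit space $X$ whose elements are the $^*$-isomorphisms from some fibre $A_x$ onto some fibre $A_y$, under composition. For $q=s,r$ let $q^*A=A\otimes_{C_0(X),q}C_0(\Gamma)$ be the maximal $C_0(X)$-balanced tensor product, where $C_0(X)$ acts on $C_0(\Gamma)$ by $(fF)(\gamma)=f(q(\gamma))F(\gamma)$. It is a $C_0(\Gamma)$-algebra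 with $g(a\otimes F)=a\otimes gF$, and its fibre $(q^*A)_\gamma$ is identified with $A_{q(\gamma)}$ by $(a\otimes F)_\gamma\mapsto F(\gamma)\,a_{q(\gamma)}$. A $\Gamma$-algebra structure on $A$ is a $C_0(\Gamma)$-linear $^*$-isomorphism $\alpha:s^*A\to r^*A$ such that the induced isomorphisms of the fibres $\alpha_\gamma:A_{s(\gamma)}=(s^*A)_\gamma\to(r^*A)_\gamma=A_{r(\gamma)}$ satisfy $\alpha_{\gamma\gamma'}=\alpha_\gamma\alpha_{\gamma'}$ whenever $s(\gamma)=r(\gamma')$, and $\alpha_{\gamma^{-1}}=(\alpha_\gamma)^{-1}$ for all $\gamma$. The algebra $A$ is a $\Gamma$-algebra if it admits such a structure. Then $A$ is a $\Gamma$-algebra if and only if there is a groupoid homomorphism $\gamma\mapsto\alpha_\gamma$ from $\Gamma$ into $Iso(A^\sharp)$, equal to the identity on the unit space $X$, such that for each $a\in A$ the map $\gamma\mapsto\alpha_\gamma(a_{s(\gamma)})$ from $\Gamma$ to $A^\sharp$ is continuous. More precisely, a groupoid homomorphism $\gamma\mapsto\alpha_\gamma$ from $\Gamma$ into $Iso(A^\sharp)$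 that is the identity on $X$ has this continuity property if and only if it is the family of fibre isomorphisms induced by some $\Gamma$-algebra structure on $A$. -/

import Mathlib

open scoped MultiplierAlgebra ZeroAtInfty TensorProduct ENNReal Topology

noncomputable section

namespace GroupoidCStar

/-! ### `C₀(X)`-algebras and their fibres -/

section C0Algebras

/-- A `C₀(X)`-algebra: a C⋆-algebra `A` with a ⋆-homomorphism `θ` from `C₀(X)` into the centre of
the multiplier algebra of `A` which is nondegenerate. Nondegeneracy is stated as density of the
span of the products `θ(f) a`; by the Cohen factorisation theorem this is the same as
`θ(C₀(X)) A = A`. -/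
class C0Algebra (X : Type*) [TopologicalSpace X] (A : Type*) [NonUnitalCStarAlgebra A] where
  /-- the structure homomorphism `C₀(X) → ZM(A)` -/
  θ : C₀(X, ℂ) →⋆ₙₐ[ℂ] 𝓜(ℂ, A)
  central : ∀ (f : C₀(X, ℂ)) (m : 𝓜(ℂ, A)), θ f * m = m * θ f
  nondegenerate :
    (Submodule.span ℂ {b : A | ∃ (f : C₀(X, ℂ)) (a : A), (θ f).fst a = b}).topologicalClosure = ⊤

variable {X : Type*} [TopologicalSpace X] {A : Type*} [NonUnitalCStarAlgebra A] [C0Algebra X A]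

/-- The module action `f a = θ(f) a` of `C₀(X)` on a `C₀(X)`-algebra. -/
def act (f : C₀(X, ℂ)) (a : A) : A := (C0Algebra.θ (A := A) f).fst a

theorem act_add (f : C₀(X, ℂ)) (a b : A) : act f (a + b) = act f a + act f b := map_add _ _ _

theorem act_smul (f : C₀(X, ℂ)) (c : ℂ) (a : A) : act f (c • a) = c • act f a := map_smul _ _ _

theorem act_mul_left (f g : C₀(X, ℂ)) (a : A) : act (f * g) a = act f (act g a) := by
  simp [act]

theorem act_smul_left (c : ℂ) (f : C₀(X, ℂ)) (a : A) : act (c • f) a = c • act f a := by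
  simp [act]

theorem act_sub_left (f g : C₀(X, ℂ)) (a : A) : act (f - g) a = act f a - act g a := by
  simp [act]

theorem eq_zero_of_mul_left {a : A} (h : ∀ b, b * a = 0) : a = 0 :=
  CStarRing.star_mul_self_eq_zero_iff a |>.mp (h _)

theorem act_mul (f : C₀(X, ℂ)) (a b : A) : act f (a * b) = act f a * b := by
  rw [← sub_eq_zero]
  refine eq_zero_of_mul_left fun z ↦ ?_
  have h := (C0Algebra.θ (A := A) f).central
  simp only [act, mul_sub, ← mul_assoc, ← h, sub_self]

theorem mul_act (f : C₀(X, ℂ)) (a b : A) : a * act f b = act f (a * b) := by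
  have h := C0Algebra.central (A := A) f (DoubleCentralizer.coe ℂ a)
  have := congrArg (fun m : 𝓜(ℂ, A) ↦ m.fst b) h
  simpa [act] using this.symm

theorem snd_eq_act (f : C₀(X, ℂ)) (a : A) : (C0Algebra.θ (A := A) f).snd a = act f a := by
  rw [← sub_eq_zero, ← star_eq_zero]
  refine eq_zero_of_mul_left fun z ↦ ?_
  rw [← star_eq_zero]
  simp only [star_mul, star_star, sub_mul]
  rw [(C0Algebra.θ (A := A) f).central, ← act_mul, ← mul_act]
  exact sub_self _

theorem star_act (f : C₀(X, ℂ)) (a : A) : star (act f a) = act (star f) (star a) := by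
  rw [← snd_eq_act (star f), map_star (C0Algebra.θ (A := A)), DoubleCentralizer.star_snd, star_star]
  rfl

theorem continuous_act (f : C₀(X, ℂ)) : Continuous fun a : A ↦ act f a :=
  (C0Algebra.θ (A := A) f).fst.continuous

variable (X A) in
/-- The ideal `I_x A` of `A`, where `I_x = {f ∈ C₀(X) | f(x) = 0}`: the closed linear span of the
products `f a` with `f ∈ I_x` and `a ∈ A` (by Cohen factorisation it is also the set of all such
products). -/
def idealAt (x : X) : Submodule ℂ A :=
  (Submodule.span ℂ {b : A | ∃ (f : C₀(X, ℂ)) (a : A), f x = 0 ∧ act f a = b}).topologicalClosure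

instance isClosed_idealAt (x : X) : IsClosed (idealAt X A x : Set A) :=
  Submodule.isClosed_topologicalClosure _

theorem act_mem_idealAt {x : X} {f : C₀(X, ℂ)} (hf : f x = 0) (a : A) : act f a ∈ idealAt X A x :=
  Submodule.le_topologicalClosure _ (Submodule.subset_span ⟨f, a, hf, rfl⟩)

/-- A closed-subspace criterion: a continuous additive and homogeneous map sends `I_x A` into a
closed subspace as soon as it does so on the products `f a`. -/
theorem idealAt_induction {x : X} {B : Type*} [TopologicalSpace B] [AddCommGroup B] [Module ℂ B]
    (S : Submodule ℂ B) (hS : IsClosed (S : Set B)) (T : A → B) (hT : Continuous T)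
    (h0 : T 0 = 0)
    (hadd : ∀ a b, T (a + b) = T a + T b) (hsmul : ∀ (c : ℂ) a, T a ∈ S → T (c • a) ∈ S)
    (h : ∀ (f : C₀(X, ℂ)) (a : A), f x = 0 → T (act f a) ∈ S) {a : A} (ha : a ∈ idealAt X A x) :
    T a ∈ S := by
  have hcl : IsClosed (T ⁻¹' (S : Set B)) := hS.preimage hT
  refine closure_minimal (s := (Submodule.span ℂ
    {b : A | ∃ (f : C₀(X, ℂ)) (a : A), f x = 0 ∧ act f a = b} : Set A)) ?_ hcl ha
  intro b hb
  refine Submodule.span_induction ?_ ?_ ?_ ?_ hb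
  · rintro _ ⟨f, a, hf, rfl⟩
    exact h f a hf
  · simp [h0]
  · intro a b _ _ ha hb
    simpa [hadd] using S.add_mem ha hb
  · intro c a _ ha
    exact hsmul c a ha

theorem idealAt_mul_left {x : X} (b : A) {a : A} (ha : a ∈ idealAt X A x) :
    b * a ∈ idealAt X A x := by
  refine idealAt_induction (idealAt X A x) (isClosed_idealAt x) (fun a ↦ b * a) (by fun_prop)
    (by simp) (by simp [mul_add]) ?_ ?_ ha
  · intro c a h
    simpa [mul_smul_comm, smul_mul_assoc] using Submodule.smul_mem _ c h
  · intro f a hf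
    simpa [mul_act] using act_mem_idealAt hf (b * a)

theorem idealAt_mul_right {x : X} (b : A) {a : A} (ha : a ∈ idealAt X A x) :
    a * b ∈ idealAt X A x := by
  refine idealAt_induction (idealAt X A x) (isClosed_idealAt x) (fun a ↦ a * b) (by fun_prop)
    (by simp) (by simp [add_mul]) ?_ ?_ ha
  · intro c a h
    simpa [mul_smul_comm, smul_mul_assoc] using Submodule.smul_mem _ c h
  · intro f a hf
    simpa [← act_mul] using act_mem_idealAt hf (a * b)

theorem idealAt_star {x : X} {a : A} (ha : a ∈ idealAt X A x) : star a ∈ idealAt X A x := by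
  refine idealAt_induction (idealAt X A x) (isClosed_idealAt x) (fun a ↦ star a) (by fun_prop)
    (by simp) (by simp) ?_ ?_ ha
  · intro c a h
    simpa using Submodule.smul_mem _ _ h
  · intro f a hf
    simpa [star_act] using act_mem_idealAt (x := x) (f := star f) (by simp [hf]) (star a)

variable (X A) in
/-- The fibre `A_x = A / (I_x A)` of a `C₀(X)`-algebra. -/
def Fiber (x : X) : Type _ := A ⧸ idealAt X A x

namespace Fiber

variable {x : X}

instance instNormedAddCommGroup : NormedAddCommGroup (Fiber X A x) :=
  inferInstanceAs (NormedAddCommGroup (A ⧸ idealAt X A x))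

instance instNormedSpace : NormedSpace ℂ (Fiber X A x) :=
  inferInstanceAs (NormedSpace ℂ (A ⧸ idealAt X A x))

instance instCompleteSpace : CompleteSpace (Fiber X A x) :=
  inferInstanceAs (CompleteSpace (A ⧸ idealAt X A x))

variable (X A x) in
/-- The quotient map `A → A_x` as a linear map. -/
def mkₗ : A →ₗ[ℂ] Fiber X A x := (idealAt X A x).mkQ

theorem mkₗ_surjective : Function.Surjective (mkₗ X A x) := Submodule.mkQ_surjective _

theorem mkₗ_eq_iff {a b : A} : mkₗ X A x a = mkₗ X A x b ↔ a - b ∈ idealAt X A x :=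
  Submodule.Quotient.eq _

theorem norm_mkₗ_le (a : A) : ‖mkₗ X A x a‖ ≤ ‖a‖ := Submodule.Quotient.norm_mk_le _ a

theorem norm_mkₗ_lt (z : Fiber X A x) {ε : ℝ} (hε : 0 < ε) :
    ∃ a, mkₗ X A x a = z ∧ ‖a‖ < ‖z‖ + ε := Submodule.Quotient.norm_mk_lt z hε

instance instMul : Mul (Fiber X A x) where
  mul := Quotient.map₂ (· * ·) (by
    intro a b hab c d hcd
    have hab' : a - b ∈ idealAt X A x := (Submodule.quotientRel_def _).mp hab
    have hcd' : c - d ∈ idealAt X A x := (Submodule.quotientRel_def _).mp hcd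
    refine (Submodule.quotientRel_def _).mpr ?_
    have h : a * c - b * d = (a - b) * c + b * (c - d) := by
      rw [sub_mul, mul_sub]; abel
    change a * c - b * d ∈ _
    rw [h]
    exact Submodule.add_mem _ (idealAt_mul_right _ hab') (idealAt_mul_left _ hcd'))

instance instStar : Star (Fiber X A x) where
  star := Quotient.map star (by
    intro a b hab
    have hab' : a - b ∈ idealAt X A x := (Submodule.quotientRel_def _).mp hab
    refine (Submodule.quotientRel_def _).mpr ?_
    rw [← star_sub]
    exact idealAt_star hab')

theorem mkₗ_mul (a b : A) : mkₗ X A x (a * b) = mkₗ X A x a * mkₗ X A x b := rfl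

theorem mkₗ_star (a : A) : mkₗ X A x (star a) = star (mkₗ X A x a) := rfl

/-- The quotient of a C⋆-algebra by the closed ideal `I_x A` satisfies the C⋆-inequality. -/
theorem norm_mul_self_le (a : A) :
    ‖mkₗ X A x a‖ * ‖mkₗ X A x a‖ ≤ ‖mkₗ X A x (star a * a)‖ := by
  let _ := CStarAlgebra.spectralOrder A
  have _ := CStarAlgebra.spectralOrderedRing A
  refine le_of_forall_pos_le_add fun ε hε ↦ ?_
  obtain ⟨c, hc, hcn⟩ := norm_mkₗ_lt (mkₗ X A x (star a * a)) (half_pos hε)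
  have hi : c - star a * a ∈ idealAt X A x := mkₗ_eq_iff.mp hc
  let J : NonUnitalStarSubalgebra ℂ A :=
    { idealAt X A x with
      mul_mem' := fun _ hb ↦ idealAt_mul_left _ hb
      star_mem' := fun ha ↦ idealAt_star ha }
  have _ : IsClosed (J : Set A) := isClosed_idealAt x
  let _ := CStarAlgebra.spectralOrder J
  have _ := CStarAlgebra.spectralOrderedRing J
  have hau := CStarAlgebra.increasingApproximateUnit J
  have _ : (CStarAlgebra.approximateUnit J).NeBot := hau.toIsApproximateUnit.neBot
  have hlim := hau.tendsto_mul_right ⟨c - star a * a, hi⟩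
  obtain ⟨e, he0, hen, hed⟩ := (hau.eventually_nonneg.and (hau.eventually_norm.and
    (Metric.tendsto_nhds.mp hlim (ε / 2) (half_pos hε)))).exists
  have hei : (e : A) ∈ idealAt X A x := e.2
  have he0' : (0 : A) ≤ (e : A) := by
    obtain ⟨y, hy⟩ := CStarAlgebra.nonneg_iff_eq_star_mul_self.mp he0
    have hy' : (e : A) = star (y : A) * (y : A) := congrArg Subtype.val hy
    rw [hy']
    exact star_mul_self_nonneg _
  have hen' : ‖(e : A)‖ ≤ 1 := hen
  have hes : star (e : A) = e := (IsSelfAdjoint.of_nonneg he0').star_eq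
  have hcontr : ∀ z : A, ‖z - e * z‖ ≤ ‖z‖ := fun z ↦ by
    refine CStarAlgebra.norm_sub_mul_self_le_of_inr z le_rfl he0' hen' (norm_nonneg _) ?_
    simp only [Unitization.inr_zero, sub_zero, mul_one]
    rw [CStarRing.norm_star_mul_self, Unitization.norm_inr, sq]
  have hcontr' : ∀ z : A, ‖z - z * e‖ ≤ ‖z‖ := fun z ↦ by
    have := hcontr (star z)
    rwa [← norm_star, norm_star z, star_sub, star_mul, star_star, hes] at this
  have hq : mkₗ X A x a = mkₗ X A x (a - a * e) :=
    mkₗ_eq_iff.mpr (by simpa using idealAt_mul_left a hei)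
  set i := c - star a * a with hidef
  have hd : ‖i - e * i‖ < ε / 2 := by
    have h : ‖(e * ⟨i, hi⟩ - ⟨i, hi⟩ : J)‖ < ε / 2 := by simpa [dist_eq_norm] using hed
    rw [norm_sub_rev]
    exact h
  have hsq : ‖a - a * e‖ * ‖a - a * e‖ ≤ ‖c‖ + ε / 2 := by
    rw [← CStarRing.norm_star_mul_self]
    have h1 : star (a - a * e) * (a - a * e)
        = ((c - e * c) - (c - e * c) * e) - ((i - e * i) - (i - e * i) * e) := by
      rw [star_sub, star_mul, hes, hidef]
      simp only [mul_sub, sub_mul, mul_assoc]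
      abel
    rw [h1]
    calc _ ≤ ‖(c - e * c) - (c - e * c) * e‖ + ‖(i - e * i) - (i - e * i) * e‖ := norm_sub_le _ _
      _ ≤ ‖c - e * c‖ + ‖i - e * i‖ := add_le_add (hcontr' _) (hcontr' _)
      _ ≤ ‖c‖ + ε / 2 := add_le_add (hcontr _) hd.le
  calc _ ≤ ‖a - a * e‖ * ‖a - a * e‖ := by
        rw [hq]; exact mul_self_le_mul_self (norm_nonneg _) (norm_mkₗ_le _)
    _ ≤ ‖c‖ + ε / 2 := hsq
    _ ≤ _ := by linarith

instance instNonUnitalRing : NonUnitalRing (Fiber X A x) :=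
  { (inferInstance : AddCommGroup (Fiber X A x)), (instMul : Mul (Fiber X A x)) with
    left_distrib := by
      rintro ⟨a⟩ ⟨b⟩ ⟨c⟩; exact congrArg (mkₗ X A x) (mul_add a b c)
    right_distrib := by
      rintro ⟨a⟩ ⟨b⟩ ⟨c⟩; exact congrArg (mkₗ X A x) (add_mul a b c)
    zero_mul := by
      rintro ⟨a⟩; exact congrArg (mkₗ X A x) (zero_mul a)
    mul_zero := by
      rintro ⟨a⟩; exact congrArg (mkₗ X A x) (mul_zero a)
    mul_assoc := by
      rintro ⟨a⟩ ⟨b⟩ ⟨c⟩; exact congrArg (mkₗ X A x) (mul_assoc a b c) }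

instance instNonUnitalNormedRing : NonUnitalNormedRing (Fiber X A x) :=
  { (instNormedAddCommGroup : NormedAddCommGroup (Fiber X A x)),
    (instNonUnitalRing : NonUnitalRing (Fiber X A x)) with
    norm_mul_le := by
      intro z w
      refine le_of_forall_gt_imp_ge_of_dense fun r hr ↦ ?_
      have hcont : Filter.Tendsto (fun ε : ℝ ↦ (‖z‖ + ε) * (‖w‖ + ε)) (𝓝[>] 0)
          (𝓝 ((‖z‖ + 0) * (‖w‖ + 0))) :=
        (Continuous.tendsto (by fun_prop) 0).mono_left nhdsWithin_le_nhds
      simp only [add_zero] at hcont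
      obtain ⟨ε, hε, hε0⟩ := ((hcont.eventually (gt_mem_nhds hr)).and self_mem_nhdsWithin).exists
      obtain ⟨a, rfl, ha⟩ := norm_mkₗ_lt z hε0
      obtain ⟨b, rfl, hb⟩ := norm_mkₗ_lt w hε0
      calc ‖mkₗ X A x (a * b)‖ ≤ ‖a * b‖ := norm_mkₗ_le _
        _ ≤ ‖a‖ * ‖b‖ := norm_mul_le _ _
        _ ≤ _ := mul_le_mul ha.le hb.le (norm_nonneg _) ((norm_nonneg _).trans ha.le)
        _ ≤ r := hε.le }

instance instStarRing : StarRing (Fiber X A x) where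
  star_involutive := by
    rintro ⟨a⟩; exact congrArg (mkₗ X A x) (star_star a)
  star_mul := by
    rintro ⟨a⟩ ⟨b⟩; exact congrArg (mkₗ X A x) (star_mul a b)
  star_add := by
    rintro ⟨a⟩ ⟨b⟩; exact congrArg (mkₗ X A x) (star_add a b)

/-- The fibres of a `C₀(X)`-algebra are C⋆-algebras. -/
instance instNonUnitalCStarAlgebra : NonUnitalCStarAlgebra (Fiber X A x) where
  norm_mul_self_le := by
    rintro ⟨a⟩; exact norm_mul_self_le a
  smul_assoc := by
    rintro c ⟨a⟩ ⟨b⟩; exact congrArg (mkₗ X A x) (smul_mul_assoc c a b)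
  smul_comm := by
    rintro c ⟨a⟩ ⟨b⟩; exact congrArg (mkₗ X A x) (mul_smul_comm c a b).symm
  star_smul := by
    rintro c ⟨a⟩; exact congrArg (mkₗ X A x) (star_smul c a)

variable (X) in
/-- The quotient ⋆-homomorphism `A → A_x`, `a ↦ a_x`. -/
def mk (x : X) : A →⋆ₙₐ[ℂ] Fiber X A x where
  toFun := mkₗ X A x
  map_smul' c a := map_smul _ c a
  map_zero' := map_zero _
  map_add' := map_add _
  map_mul' := mkₗ_mul
  map_star' := mkₗ_star

theorem mk_surjective : Function.Surjective (mk (A := A) X x) := mkₗ_surjective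

theorem mk_eq_zero_iff {a : A} : mk X x a = 0 ↔ a ∈ idealAt X A x :=
  Submodule.Quotient.mk_eq_zero _

theorem continuous_mk : Continuous (mk (A := A) X x) :=
  AddMonoidHomClass.continuous_of_bound (mk (A := A) X x) 1
    fun a ↦ by rw [one_mul]; exact norm_mkₗ_le a

theorem mk_act (f : C₀(X, ℂ)) (a : A) : mk X x (act f a) = f x • mk X x a := by
  have hcl : IsClosed {a : A | mk X x (act f a) = f x • mk X x a} := by
    have hc : Continuous fun a : A ↦ f x • mk X x a := continuous_mk.const_smul (f x)
    exact isClosed_eq (continuous_mk.comp (continuous_act f)) hc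
  have hmem : a ∈ (Submodule.span ℂ {b : A | ∃ (f : C₀(X, ℂ)) (a : A),
      (C0Algebra.θ f).fst a = b}).topologicalClosure := by
    rw [C0Algebra.nondegenerate]; trivial
  refine closure_minimal ?_ hcl hmem
  intro b hb
  refine Submodule.span_induction ?_ ?_ ?_ ?_ hb
  · rintro _ ⟨g, a, rfl⟩
    change mk X x (act f (act g a)) = f x • mk X x (act g a)
    rw [← act_mul_left, ← map_smul, ← sub_eq_zero, ← map_sub, mk_eq_zero_iff,
      ← act_smul_left, ← act_sub_left]
    exact act_mem_idealAt (by simp) a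
  · simp [act]
  · intro a b _ _ ha hb
    simp only [Set.mem_ofPred_eq] at ha hb ⊢
    rw [act_add, map_add, map_add, ha, hb, smul_add]
  · intro c a _ ha
    simp only [Set.mem_ofPred_eq] at ha ⊢
    rw [act_smul, map_smul, map_smul, ha, smul_comm]

end Fiber

end C0Algebras

/-! ### The pull-back `q^* A = A ⊗_{C₀(X), q} C₀(Y)` -/

section Pullback

universe u v

variable {X : Type*} [TopologicalSpace X] {Y : Type v} [TopologicalSpace Y]
  {A : Type u} [NonUnitalCStarAlgebra A] [C0Algebra X A]

/-- The action of `C₀(X)` on `C₀(Y)` through a continuous map `q : Y → X`: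
`(f F)(y) = f(q(y)) F(y)`. -/
def compMul (q : C(Y, X)) (f : C₀(X, ℂ)) (F : C₀(Y, ℂ)) : C₀(Y, ℂ) where
  toFun y := f (q y) * F y
  continuous_toFun := by fun_prop
  zero_at_infty' := by
    obtain ⟨C, hC⟩ := f.isBounded_range.exists_norm_le
    refine Filter.Tendsto.zero_mul_isBoundedUnder_le (F.zero_at_infty') ?_ |>.congr
      (fun y ↦ mul_comm _ _)
    exact Filter.isBoundedUnder_of ⟨C, fun y ↦ hC _ ⟨q y, rfl⟩⟩

@[simp] theorem compMul_apply (q : C(Y, X)) (f : C₀(X, ℂ)) (F : C₀(Y, ℂ)) (y : Y) :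
    compMul q f F y = f (q y) * F y := rfl

variable (A) in
/-- A `C₀(X)`-balanced pair of commuting ⋆-homomorphisms of `A` and `C₀(Y)` into a C⋆-algebra. -/
structure BalancedPair (q : C(Y, X)) (D : Type*) [NonUnitalCStarAlgebra D] where
  fst : A →⋆ₙₐ[ℂ] D
  snd : C₀(Y, ℂ) →⋆ₙₐ[ℂ] D
  commute : ∀ a F, fst a * snd F = snd F * fst a
  balanced : ∀ (f : C₀(X, ℂ)) a F, fst (act f a) * snd F = fst a * snd (compMul q f F)

namespace BalancedPair

variable {q : C(Y, X)} {D : Type*} [NonUnitalCStarAlgebra D]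

/-- The linear map `a ⊗ F ↦ π(a) ρ(F)` on the algebraic tensor product `A ⊙ C₀(Y)`. -/
def lift (P : BalancedPair A q D) : A ⊗[ℂ] C₀(Y, ℂ) →ₗ[ℂ] D :=
  TensorProduct.lift (LinearMap.mk₂ ℂ (fun a F ↦ P.fst a * P.snd F)
    (fun a b F ↦ by rw [map_add, add_mul]) (fun c a F ↦ by rw [map_smul, smul_mul_assoc])
    (fun a F G ↦ by rw [map_add, mul_add]) (fun c a F ↦ by rw [map_smul, mul_smul_comm]))

@[simp] theorem lift_tmul (P : BalancedPair A q D) (a : A) (F : C₀(Y, ℂ)) :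
    P.lift (a ⊗ₜ F) = P.fst a * P.snd F := rfl

variable (A q) in
/-- The C⋆-seminorms `t ↦ ‖(π ⊗ ρ)(t)‖` on `A ⊙ C₀(Y)` given by balanced pairs `(π, ρ)`. -/
def Seminorms : Type (max u v) :=
  {p : A ⊗[ℂ] C₀(Y, ℂ) → ℝ // ∃ (D : Type (max u v)) (_ : NonUnitalCStarAlgebra D)
    (P : BalancedPair A q D), ∀ t, p t = ‖P.lift t‖}

/-- A C⋆-algebra that carries a balanced pair with the given seminorm. -/
def Target (p : Seminorms A q) : Type (max u v) := p.2.choose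

instance (p : Seminorms A q) : NonUnitalCStarAlgebra (Target p) := p.2.choose_spec.choose

/-- A balanced pair with the given seminorm. -/
def pair (p : Seminorms A q) : BalancedPair A q (Target p) := p.2.choose_spec.choose_spec.choose

theorem norm_pair_lift (p : Seminorms A q) (t : A ⊗[ℂ] C₀(Y, ℂ)) : ‖(pair p).lift t‖ = p.1 t :=
  (p.2.choose_spec.choose_spec.choose_spec t).symm

/-- A family of ⋆-homomorphisms into C⋆-algebras as one into their `ℓ^∞`-product. -/
def prodHom {B : Type*} [NonUnitalCStarAlgebra B] {ι : Type*} (D : ι → Type*)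
    [∀ i, NonUnitalCStarAlgebra (D i)] (φ : ∀ i, B →⋆ₙₐ[ℂ] D i) : B →⋆ₙₐ[ℂ] lp D ∞ where
  toFun b := ⟨fun i ↦ φ i b, memℓp_infty ⟨‖b‖, by
    rintro _ ⟨i, rfl⟩; exact NonUnitalStarAlgHom.norm_apply_le (φ i) b⟩⟩
  map_smul' c b := by ext i; exact map_smul (φ i) c b
  map_zero' := by ext i; exact map_zero (φ i)
  map_add' a b := by ext i; exact map_add (φ i) a b
  map_mul' a b := by ext i; exact map_mul (φ i) a b
  map_star' b := by ext i; exact map_star (φ i) b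

variable (A q) in
/-- The universal balanced pair: the product of one balanced pair for each seminorm. -/
def universal : BalancedPair A q (lp (Target (A := A) (q := q)) ∞) where
  fst := prodHom _ fun p ↦ (pair p).fst
  snd := prodHom _ fun p ↦ (pair p).snd
  commute a F := by ext p; exact (pair p).commute a F
  balanced f a F := by ext p; exact (pair p).balanced f a F

theorem universal_lift_apply (t : A ⊗[ℂ] C₀(Y, ℂ)) (p : Seminorms A q) :
    (universal A q).lift t p = (pair p).lift t := by
  induction t with
  | zero => simp
  | tmul a F => rfl
  | add s t hs ht => rw [map_add, map_add, ← hs, ← ht]; rfl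

/-- The universal pair realises the maximal balanced C⋆-seminorm: its norm dominates the one given
by any balanced pair. -/
theorem norm_lift_le_universal {D : Type (max u v)} [NonUnitalCStarAlgebra D]
    (P : BalancedPair A q D) (t : A ⊗[ℂ] C₀(Y, ℂ)) : ‖P.lift t‖ ≤ ‖(universal A q).lift t‖ := by
  let p : Seminorms A q := ⟨fun t ↦ ‖P.lift t‖, D, inferInstance, P, fun _ ↦ rfl⟩
  calc ‖P.lift t‖ = ‖(universal A q).lift t p‖ := by rw [universal_lift_apply, norm_pair_lift]
    _ ≤ _ := lp.norm_apply_le_norm ENNReal.top_ne_zero _ p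

theorem norm_lift_le_universal' {D : Type u} [NonUnitalCStarAlgebra D]
    (P : BalancedPair A q D) (t : A ⊗[ℂ] C₀(Y, ℂ)) : ‖P.lift t‖ ≤ ‖(universal A q).lift t‖ := by
  let Q : BalancedPair A q (lp (fun _ : PUnit.{v + 1} ↦ D) ∞) :=
    { fst := prodHom _ fun _ ↦ P.fst
      snd := prodHom _ fun _ ↦ P.snd
      commute := fun a F ↦ by ext p; exact P.commute a F
      balanced := fun f a F ↦ by ext p; exact P.balanced f a F }
  have hQ : Q.lift t PUnit.unit = P.lift t := by
    induction t with
    | zero => simp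
    | tmul a F => rfl
    | add s t hs ht => rw [map_add, map_add, ← hs, ← ht]; rfl
  calc ‖P.lift t‖ = ‖Q.lift t PUnit.unit‖ := by rw [hQ]
    _ ≤ ‖Q.lift t‖ := lp.norm_apply_le_norm ENNReal.top_ne_zero _ _
    _ ≤ ‖(universal A q).lift t‖ := norm_lift_le_universal Q t

end BalancedPair

open BalancedPair

variable (A) in
/-- The range of the universal balanced pair on the algebraic tensor product, a ⋆-algebra. -/
def algPullback (q : C(Y, X)) : NonUnitalStarSubalgebra ℂ (lp (Target (A := A) (q := q)) ∞) where
  __ := LinearMap.range (universal A q).lift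
  mul_mem' := by
    rintro _ _ ⟨s, rfl⟩ ⟨t, rfl⟩
    induction s with
    | zero => exact ⟨0, by simp⟩
    | add s s' hs hs' =>
      obtain ⟨w, hw⟩ := hs
      obtain ⟨w', hw'⟩ := hs'
      exact ⟨w + w', by rw [map_add, map_add, add_mul, hw, hw']⟩
    | tmul a F =>
      induction t with
      | zero => exact ⟨0, by simp⟩
      | add s s' hs hs' =>
        obtain ⟨w, hw⟩ := hs
        obtain ⟨w', hw'⟩ := hs'
        exact ⟨w + w', by rw [map_add, map_add, mul_add, hw, hw']⟩
      | tmul b G =>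
        refine ⟨(a * b) ⊗ₜ (F * G), ?_⟩
        simp only [lift_tmul, map_mul]
        rw [mul_assoc, ← mul_assoc _ _ (BalancedPair.snd _ G), commute]
        simp only [mul_assoc]
  star_mem' := by
    rintro _ ⟨t, rfl⟩
    induction t with
    | zero => exact ⟨0, by simp⟩
    | add s s' hs hs' =>
      obtain ⟨w, hw⟩ := hs
      obtain ⟨w', hw'⟩ := hs'
      exact ⟨w + w', by rw [map_add, map_add, star_add, hw, hw']⟩
    | tmul a F =>
      exact ⟨star a ⊗ₜ star F, by
        rw [lift_tmul, lift_tmul, star_mul, map_star, map_star, ← map_star (universal A q).fst,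
          ← map_star (universal A q).snd, commute]⟩

variable (A) in
/-- The pull-back `q^* A = A ⊗_{C₀(X), q} C₀(Y)`: the maximal `C₀(X)`-balanced C⋆-tensor product.
It is the quotient of `A ⊗_max C₀(Y)` by the closed ideal generated by the differences
`f a ⊗ F - a ⊗ f F`, that is, the (Hausdorff) completion of the algebraic tensor product `A ⊙ C₀(Y)` in the largest
C⋆-seminorm that comes from a balanced pair, realised as the closure of the range of the universal
balanced pair. -/
def Pullback (q : C(Y, X)) : Type (max u v) := (algPullback A q).topologicalClosure

namespace Pullback

variable {q : C(Y, X)}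

instance : NonUnitalCStarAlgebra (Pullback A q) :=
  have : IsClosed ((algPullback A q).topologicalClosure : Set (lp (Target (A := A) (q := q)) ∞)) :=
    NonUnitalStarSubalgebra.isClosed_topologicalClosure _
  inferInstanceAs (NonUnitalCStarAlgebra (algPullback A q).topologicalClosure)

variable (A q) in
/-- The inclusion of `q^* A` in the ambient product. -/
def incl : Pullback A q →⋆ₙₐ[ℂ] lp (Target (A := A) (q := q)) ∞ :=
  NonUnitalStarSubalgebraClass.subtype (algPullback A q).topologicalClosure

theorem incl_injective : Function.Injective (incl A q) := Subtype.val_injective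

theorem norm_incl (z : Pullback A q) : ‖incl A q z‖ = ‖z‖ := rfl

variable (A q) in
/-- The canonical map `A ⊙ C₀(Y) → q^* A`. -/
def ofAlg : A ⊗[ℂ] C₀(Y, ℂ) →ₗ[ℂ] Pullback A q :=
  LinearMap.codRestrict (algPullback A q).topologicalClosure.toSubmodule (universal A q).lift
    fun t ↦ NonUnitalStarSubalgebra.le_topologicalClosure _ ⟨t, rfl⟩

@[simp] theorem incl_ofAlg (t : A ⊗[ℂ] C₀(Y, ℂ)) :
    incl A q (ofAlg A q t) = (universal A q).lift t := rfl

theorem denseRange_ofAlg : DenseRange (ofAlg A q) := by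
  intro z
  rw [Metric.mem_closure_iff]
  intro ε hε
  have hz : incl A q z ∈ closure (algPullback A q : Set (lp (Target (A := A) (q := q)) ∞)) := z.2
  obtain ⟨_, ⟨t, rfl⟩, ht⟩ := Metric.mem_closure_iff.mp hz ε hε
  exact ⟨_, ⟨t, rfl⟩, ht⟩

/-- The elementary tensor `a ⊗ F` in `q^* A`. -/
def tmul (q : C(Y, X)) (a : A) (F : C₀(Y, ℂ)) : Pullback A q := ofAlg A q (a ⊗ₜ F)

theorem incl_tmul (a : A) (F : C₀(Y, ℂ)) :
    incl A q (tmul q a F) = (universal A q).fst a * (universal A q).snd F := rfl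

theorem tmul_act (f : C₀(X, ℂ)) (a : A) (F : C₀(Y, ℂ)) :
    tmul q (act f a) F = tmul q a (compMul q f F) :=
  incl_injective ((universal A q).balanced f a F)

theorem tmul_mul_tmul (a b : A) (F G : C₀(Y, ℂ)) :
    tmul q a F * tmul q b G = tmul q (a * b) (F * G) := by
  refine incl_injective ?_
  rw [map_mul, incl_tmul, incl_tmul, incl_tmul, map_mul, map_mul, mul_assoc,
    ← mul_assoc _ _ (BalancedPair.snd _ G), ← commute]
  simp only [mul_assoc]

theorem star_tmul (a : A) (F : C₀(Y, ℂ)) : star (tmul q a F) = tmul q (star a) (star F) := by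
  refine incl_injective ?_
  rw [map_star, incl_tmul, incl_tmul, star_mul, ← map_star (universal A q).fst,
    ← map_star (universal A q).snd, commute]

theorem tmul_add (a : A) (F G : C₀(Y, ℂ)) : tmul q a (F + G) = tmul q a F + tmul q a G := by
  simp [tmul, TensorProduct.tmul_add]

theorem tmul_sub (a : A) (F G : C₀(Y, ℂ)) : tmul q a (F - G) = tmul q a F - tmul q a G := by
  simp [tmul, TensorProduct.tmul_sub]

theorem tmul_smul (a : A) (c : ℂ) (F : C₀(Y, ℂ)) : tmul q a (c • F) = c • tmul q a F := by
  simp [tmul]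

theorem smul_tmul (a : A) (c : ℂ) (F : C₀(Y, ℂ)) : tmul q (c • a) F = c • tmul q a F := by
  rw [tmul, ← TensorProduct.smul_tmul', map_smul]; rfl

theorem add_tmul (a b : A) (F : C₀(Y, ℂ)) : tmul q (a + b) F = tmul q a F + tmul q b F := by
  simp [tmul, TensorProduct.add_tmul]

theorem zero_tmul (F : C₀(Y, ℂ)) : tmul q (0 : A) F = 0 := by
  simp [tmul]

theorem continuous_tmul (a : A) : Continuous fun F ↦ tmul q a F := by
  have h : Continuous fun F ↦ (universal A q).fst a * (universal A q).snd F :=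
    continuous_const.mul (AddMonoidHomClass.continuous_of_bound (universal A q).snd 1
      fun F ↦ by rw [one_mul]; exact NonUnitalStarAlgHom.norm_apply_le _ F)
  exact h.subtype_mk _

theorem continuous_tmul_left (F : C₀(Y, ℂ)) : Continuous fun a : A ↦ tmul q a F := by
  have h : Continuous fun a ↦ (universal A q).fst a * (universal A q).snd F :=
    (AddMonoidHomClass.continuous_of_bound (universal A q).fst 1
      fun F ↦ by rw [one_mul]; exact NonUnitalStarAlgHom.norm_apply_le _ F).mul continuous_const
  exact h.subtype_mk _

/-- A closed-subspace criterion on elementary tensors. -/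
theorem induction_on (S : Submodule ℂ (Pullback A q)) (hS : IsClosed (S : Set (Pullback A q)))
    (h : ∀ a F, tmul q a F ∈ S) (z : Pullback A q) : z ∈ S := by
  refine closure_minimal (s := Set.range (ofAlg A q)) ?_ hS (denseRange_ofAlg z)
  rintro _ ⟨t, rfl⟩
  induction t with
  | zero => simp
  | tmul a F => exact h a F
  | add s t hs ht => simpa using S.add_mem hs ht

theorem snd_mul_mem (g : C₀(Y, ℂ)) (z : Pullback A q) :
    (universal A q).snd g * incl A q z ∈ (algPullback A q).topologicalClosure := by
  let T : Pullback A q →ₗ[ℂ] lp (Target (A := A) (q := q)) ∞ :=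
    { toFun := fun z ↦ (universal A q).snd g * incl A q z
      map_add' := fun z w ↦ by rw [map_add, mul_add]
      map_smul' := fun c z ↦ by rw [map_smul, mul_smul_comm]; rfl }
  have hT : Continuous T := continuous_const.mul continuous_subtype_val
  refine induction_on ((algPullback A q).topologicalClosure.toSubmodule.comap T)
    ((NonUnitalStarSubalgebra.isClosed_topologicalClosure (algPullback A q)).preimage hT) ?_ z
  intro a F
  change (universal A q).snd g * incl A q (tmul q a F) ∈ (algPullback A q).topologicalClosure
  rw [incl_tmul, ← mul_assoc, ← commute, mul_assoc, ← map_mul, ← incl_tmul]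
  exact (tmul q a (g * F)).2

theorem snd_mul_comm (g : C₀(Y, ℂ)) (z : Pullback A q) :
    (universal A q).snd g * incl A q z = incl A q z * (universal A q).snd g := by
  let T : Pullback A q →ₗ[ℂ] lp (Target (A := A) (q := q)) ∞ :=
    { toFun := fun z ↦ (universal A q).snd g * incl A q z - incl A q z * (universal A q).snd g
      map_add' := fun z w ↦ by rw [map_add, mul_add, add_mul]; abel
      map_smul' := fun c z ↦ by
        rw [map_smul, mul_smul_comm, smul_mul_assoc, smul_sub]; rfl }
  have hT : Continuous T :=
    (continuous_const.mul continuous_subtype_val).sub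
      (continuous_subtype_val.mul continuous_const)
  have := induction_on (LinearMap.ker T) (isClosed_singleton.preimage hT) ?_ z
  · exact sub_eq_zero.mp this
  intro a F
  change (universal A q).snd g * incl A q (tmul q a F)
    - incl A q (tmul q a F) * (universal A q).snd g = 0
  rw [incl_tmul, ← mul_assoc, ← commute, mul_assoc, mul_assoc, ← map_mul, ← map_mul, mul_comm g F,
    sub_self]

variable (A q) in
/-- Multiplication by `g ∈ C₀(Y)` on `q^* A`. -/
def mulOp (g : C₀(Y, ℂ)) : Pullback A q →L[ℂ] Pullback A q where
  toFun z := ⟨(universal A q).snd g * incl A q z, snd_mul_mem g z⟩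
  map_add' z w := Subtype.ext (show (universal A q).snd g * incl A q (z + w)
    = (universal A q).snd g * incl A q z + (universal A q).snd g * incl A q w by
      rw [map_add, mul_add])
  map_smul' c z := Subtype.ext (show (universal A q).snd g * incl A q (c • z)
    = c • ((universal A q).snd g * incl A q z) by rw [map_smul, mul_smul_comm])
  cont := (continuous_const.mul continuous_subtype_val).subtype_mk _

theorem incl_mulOp (g : C₀(Y, ℂ)) (z : Pullback A q) :
    incl A q (mulOp A q g z) = (universal A q).snd g * incl A q z := rfl

theorem mulOp_tmul (g : C₀(Y, ℂ)) (a : A) (F : C₀(Y, ℂ)) :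
    mulOp A q g (tmul q a F) = tmul q a (g * F) :=
  incl_injective (by
    rw [incl_mulOp, incl_tmul, incl_tmul, ← mul_assoc, ← commute, mul_assoc, ← map_mul])

theorem mulOp_mul (g : C₀(Y, ℂ)) (z w : Pullback A q) :
    mulOp A q g (z * w) = mulOp A q g z * w :=
  incl_injective (by simp only [incl_mulOp, map_mul, mul_assoc])

theorem mul_mulOp (g : C₀(Y, ℂ)) (z w : Pullback A q) :
    z * mulOp A q g w = mulOp A q g (z * w) :=
  incl_injective (by
    rw [map_mul, incl_mulOp, incl_mulOp, map_mul, ← mul_assoc, ← snd_mul_comm g z, mul_assoc])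

theorem star_mulOp (g : C₀(Y, ℂ)) (z : Pullback A q) :
    star (mulOp A q g z) = mulOp A q (star g) (star z) :=
  incl_injective (by
    rw [map_star, incl_mulOp, incl_mulOp, snd_mul_comm, star_mul, map_star, map_star])

/-- Every `F ∈ C₀(Y)` is a limit of products `g F`. -/
theorem mem_of_mul_mem {S : Set C₀(Y, ℂ)} (hS : IsClosed S) {F : C₀(Y, ℂ)}
    (h : ∀ g, g * F ∈ S) : F ∈ S := by
  let _ := CStarAlgebra.spectralOrder C₀(Y, ℂ)
  have _ := CStarAlgebra.spectralOrderedRing C₀(Y, ℂ)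
  have hau := CStarAlgebra.increasingApproximateUnit C₀(Y, ℂ)
  have _ : (CStarAlgebra.approximateUnit C₀(Y, ℂ)).NeBot := hau.toIsApproximateUnit.neBot
  exact hS.mem_of_tendsto (hau.tendsto_mul_right F) (Filter.Eventually.of_forall h)

/-- The `C₀(Y)`-algebra structure of `q^* A`: `g (a ⊗ F) = a ⊗ g F`. -/
instance : C0Algebra Y (Pullback A q) where
  θ :=
    { toFun := fun g ↦ ⟨(mulOp A q g, mulOp A q g), fun z w ↦ by
        rw [mul_mulOp, mulOp_mul]⟩
      map_smul' := fun c g ↦ by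
        refine DoubleCentralizer.ext _ _ _ _ (Prod.ext ?_ ?_) <;>
        · ext z : 1
          exact incl_injective (by
            change _ = c • ((universal A q).snd g * incl A q z)
            change (universal A q).snd (c • g) * incl A q z = _
            rw [map_smul, smul_mul_assoc])
      map_zero' := by
        refine DoubleCentralizer.ext _ _ _ _ (Prod.ext ?_ ?_) <;>
        · ext z : 1
          exact incl_injective (by
            change (universal A q).snd 0 * incl A q z = 0
            rw [map_zero, zero_mul])
      map_add' := fun g h ↦ by
        refine DoubleCentralizer.ext _ _ _ _ (Prod.ext ?_ ?_) <;>
        · ext z : 1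
          exact incl_injective (by
            change (universal A q).snd (g + h) * incl A q z
              = (universal A q).snd g * incl A q z + (universal A q).snd h * incl A q z
            rw [map_add, add_mul])
      map_mul' := fun g h ↦ by
        refine DoubleCentralizer.ext _ _ _ _ (Prod.ext ?_ ?_)
        · ext z : 1
          exact incl_injective (by
            change (universal A q).snd (g * h) * incl A q z
              = (universal A q).snd g * ((universal A q).snd h * incl A q z)
            rw [map_mul, mul_assoc])
        · ext z : 1
          exact incl_injective (by
            change (universal A q).snd (g * h) * incl A q z
              = (universal A q).snd h * ((universal A q).snd g * incl A q z)
            rw [mul_comm, map_mul, mul_assoc])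
      map_star' := fun g ↦ by
        refine DoubleCentralizer.ext _ _ _ _ (Prod.ext ?_ ?_) <;>
        · ext z : 1
          change mulOp A q (star g) z = star (mulOp A q g (star z))
          rw [star_mulOp, star_star] }
  central g m := by
    refine DoubleCentralizer.ext _ _ _ _ (Prod.ext ?_ ?_)
    · ext z : 1
      change mulOp A q g (m.fst z) = m.fst (mulOp A q g z)
      rw [← sub_eq_zero]
      refine eq_zero_of_mul_left fun w ↦ ?_
      rw [mul_sub, ← m.central, mul_mulOp, mul_mulOp, ← m.central, sub_self]
    · ext z : 1
      change m.snd (mulOp A q g z) = mulOp A q g (m.snd z)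
      rw [← sub_eq_zero, ← star_eq_zero]
      refine eq_zero_of_mul_left fun w ↦ ?_
      rw [← star_eq_zero, star_mul, star_star, sub_mul, m.central, ← mulOp_mul, ← mulOp_mul,
        m.central, sub_self]
  nondegenerate := by
    rw [eq_top_iff]
    rintro z -
    refine induction_on _ (Submodule.isClosed_topologicalClosure _) (fun a F ↦ ?_) z
    refine mem_of_mul_mem (S := {F | tmul q a F ∈ _})
      ((Submodule.isClosed_topologicalClosure _).preimage (continuous_tmul a)) fun g ↦ ?_
    exact Submodule.le_topologicalClosure _ (Submodule.subset_span ⟨g, tmul q a F, mulOp_tmul g a F⟩)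

theorem act_tmul (g : C₀(Y, ℂ)) (a : A) (F : C₀(Y, ℂ)) :
    act g (tmul q a F) = tmul q a (g * F) := mulOp_tmul g a F

/-! #### The fibres `(q^* A)_y = A_{q(y)}` -/

/-- The linear map `a ⊗ F ↦ F(y) a_{q(y)}` on the algebraic tensor product. -/
def evAlg (A : Type u) [NonUnitalCStarAlgebra A] [C0Algebra X A] (q : C(Y, X)) (y : Y) :
    A ⊗[ℂ] C₀(Y, ℂ) →ₗ[ℂ] Fiber X A (q y) :=
  TensorProduct.lift (LinearMap.mk₂ ℂ (fun a F ↦ F y • Fiber.mk X (q y) a)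
    (fun a b F ↦ by rw [map_add, smul_add]) (fun c a F ↦ by rw [map_smul, smul_comm])
    (fun a F G ↦ by rw [← add_smul]; rfl) (fun c a F ↦ by rw [← smul_assoc]; rfl))

@[simp] theorem evAlg_tmul (y : Y) (a : A) (F : C₀(Y, ℂ)) :
    evAlg A q y (a ⊗ₜ F) = F y • Fiber.mk X (q y) a := rfl

/-- A scalar-valued character of `C₀(Y)` with values in a unital C⋆-algebra. -/
def evalHom (y : Y) (D : Type*) [CStarAlgebra D] : C₀(Y, ℂ) →⋆ₙₐ[ℂ] D where
  toFun F := algebraMap ℂ D (F y)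
  map_smul' c F := by simp [Algebra.smul_def]
  map_zero' := by simp
  map_add' F G := by simp
  map_mul' F G := by simp
  map_star' F := algebraMap_star_comm (F y)

/-- The balanced pair `a ↦ a_{q(y)}`, `F ↦ F(y)` into the multiplier algebra of `A_{q(y)}`. -/
def evPair (A : Type u) [NonUnitalCStarAlgebra A] [C0Algebra X A] (q : C(Y, X)) (y : Y) :
    BalancedPair A q 𝓜(ℂ, Fiber X A (q y)) where
  fst := (DoubleCentralizer.coeHom (𝕜 := ℂ) (A := Fiber X A (q y))).comp (Fiber.mk X (q y))
  snd := evalHom y _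
  commute a F := by
    change DoubleCentralizer.coeHom (𝕜 := ℂ) (Fiber.mk X (q y) a) * algebraMap ℂ _ (F y)
      = algebraMap ℂ _ (F y) * DoubleCentralizer.coeHom (𝕜 := ℂ) (Fiber.mk X (q y) a)
    rw [Algebra.commutes]
  balanced f a F := by
    change DoubleCentralizer.coeHom (𝕜 := ℂ) (Fiber.mk X (q y) (act f a)) * algebraMap ℂ _ (F y)
      = DoubleCentralizer.coeHom (𝕜 := ℂ) (Fiber.mk X (q y) a) * algebraMap ℂ _ (f (q y) * F y)
    rw [Fiber.mk_act, map_smul, map_mul, Algebra.smul_def, ← mul_assoc, Algebra.commutes]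

theorem norm_coeHom {B : Type*} [NonUnitalCStarAlgebra B] (b : B) :
    ‖DoubleCentralizer.coeHom (𝕜 := ℂ) b‖ = ‖b‖ := by
  refine NonUnitalStarAlgHom.norm_map _ (fun a b h ↦ ?_) b
  rw [← sub_eq_zero, ← star_eq_zero]
  refine eq_zero_of_mul_left fun w ↦ ?_
  have := congrArg (fun m : 𝓜(ℂ, B) ↦ m.fst (star w)) h
  rw [← star_eq_zero, star_mul, star_star, sub_mul, sub_eq_zero]
  exact this

theorem evPair_lift (y : Y) (t : A ⊗[ℂ] C₀(Y, ℂ)) :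
    (evPair A q y).lift t = DoubleCentralizer.coeHom (𝕜 := ℂ) (evAlg A q y t) := by
  induction t with
  | zero => rw [map_zero, map_zero, map_zero]
  | tmul a F =>
    rw [lift_tmul, evAlg_tmul, map_smul, Algebra.smul_def, Algebra.commutes]
    rfl
  | add s t hs ht => rw [map_add, map_add, map_add, hs, ht]

theorem norm_evAlg_le (y : Y) (t : A ⊗[ℂ] C₀(Y, ℂ)) : ‖evAlg A q y t‖ ≤ ‖ofAlg A q t‖ := by
  rw [← norm_coeHom, ← evPair_lift]
  exact norm_lift_le_universal' (evPair A q y) t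

theorem mem_closure_ker (y : Y) {z : Pullback A q} (hz : z ∈ idealAt Y (Pullback A q) y) :
    z ∈ ((LinearMap.ker (evAlg A q y)).map (ofAlg A q)).topologicalClosure := by
  refine idealAt_induction _ (Submodule.isClosed_topologicalClosure _) id continuous_id rfl
    (fun _ _ ↦ rfl) (fun c a h ↦ Submodule.smul_mem _ c h) ?_ hz
  intro g z hg
  refine induction_on ((Submodule.topologicalClosure _).comap (mulOp A q g).toLinearMap)
    ((Submodule.isClosed_topologicalClosure _).preimage (mulOp A q g).continuous) ?_ z
  intro a F
  refine Submodule.le_topologicalClosure _ ⟨a ⊗ₜ (g * F), ?_, ?_⟩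
  · change evAlg A q y _ = 0
    simp [hg]
  · exact (mulOp_tmul g a F).symm

theorem mk_tmul_eq_zero {y : Y} {F : C₀(Y, ℂ)} (hF : F y = 0) (a : A) :
    Fiber.mk Y y (tmul q a F) = 0 := by
  rw [Fiber.mk_eq_zero_iff]
  refine mem_of_mul_mem (S := {F | tmul q a F ∈ idealAt Y (Pullback A q) y})
    ((isClosed_idealAt y).preimage (continuous_tmul a)) fun g ↦ ?_
  change tmul q a (g * F) ∈ idealAt Y (Pullback A q) y
  rw [mul_comm, ← act_tmul]
  exact act_mem_idealAt hF _

variable [LocallyCompactSpace Y] [T2Space Y]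

theorem exists_eq_one (y : Y) : ∃ F : C₀(Y, ℂ), F y = 1 := by
  obtain ⟨f, hf, -, hc, -⟩ := exists_continuous_one_zero_of_isCompact (isCompact_singleton (x := y))
    isClosed_empty (Set.disjoint_empty _)
  refine ⟨⟨⟨fun y ↦ (f y : ℂ), by fun_prop⟩, ?_⟩, ?_⟩
  · have : HasCompactSupport fun y ↦ (f y : ℂ) := hc.comp_left (g := fun r : ℝ ↦ (r : ℂ)) (by simp)
    exact this.is_zero_at_infty
  · change ((f y : ℝ) : ℂ) = 1
    rw [hf rfl]; simp

/-- A function in `C₀(Y)` with value `1` at `y`. -/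
def bump (y : Y) : C₀(Y, ℂ) := (exists_eq_one y).choose

theorem bump_self (y : Y) : bump y y = 1 := (exists_eq_one y).choose_spec

theorem mk_tmul_eq (y : Y) (a : A) (F : C₀(Y, ℂ)) :
    Fiber.mk Y y (tmul q a F) = F y • Fiber.mk Y y (tmul q a (bump y)) := by
  rw [← map_smul, ← tmul_smul, ← sub_eq_zero, ← map_sub, ← tmul_sub]
  exact mk_tmul_eq_zero (by simp [bump_self]) a

theorem mk_tmul_bump_eq_zero_iff (y : Y) (a : A) :
    Fiber.mk Y y (tmul q a (bump y)) = 0 ↔ Fiber.mk X (q y) a = 0 := by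
  constructor
  · intro h
    rw [Fiber.mk_eq_zero_iff] at h
    have h' := mem_closure_ker y h
    rw [← norm_le_zero_iff]
    refine le_of_forall_pos_le_add fun ε hε ↦ ?_
    obtain ⟨_, ⟨t, ht, rfl⟩, hd⟩ := Metric.mem_closure_iff.mp h' ε hε
    have ht' : evAlg A q y t = 0 := ht
    have h1 := norm_evAlg_le (q := q) y (a ⊗ₜ bump y - t)
    rw [map_sub, ht', sub_zero, evAlg_tmul, bump_self, one_smul, map_sub] at h1
    rw [dist_eq_norm] at hd
    rw [zero_add]
    exact h1.trans hd.le
  · intro h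
    rw [Fiber.mk_eq_zero_iff] at h ⊢
    refine idealAt_induction (idealAt Y (Pullback A q) y) (isClosed_idealAt y)
      (fun a ↦ tmul q a (bump y)) (continuous_tmul_left _) ?_ ?_ ?_ ?_ h
    · exact zero_tmul _
    · intro a b; exact add_tmul a b _
    · intro c a h
      simpa only [smul_tmul] using Submodule.smul_mem _ c h
    · intro f a hf
      rw [tmul_act, ← Fiber.mk_eq_zero_iff]
      exact mk_tmul_eq_zero (by simp [hf]) a

/-- The ⋆-homomorphism `A → (q^* A)_y`, `a ↦ (a ⊗ F)_y` for any `F` with `F(y) = 1`. -/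
def toFiber (A : Type u) [NonUnitalCStarAlgebra A] [C0Algebra X A] (q : C(Y, X)) (y : Y) :
    A →⋆ₙₐ[ℂ] Fiber Y (Pullback A q) y where
  toFun a := Fiber.mk Y y (tmul q a (bump y))
  map_smul' c a := by
    rw [← map_smul]
    exact congrArg _ (smul_tmul a c _)
  map_zero' := by rw [mk_tmul_bump_eq_zero_iff, map_zero]
  map_add' a b := by
    rw [← map_add]
    exact congrArg _ (add_tmul a b _)
  map_mul' a b := by
    rw [← map_mul, tmul_mul_tmul, mk_tmul_eq y (a * b) (bump y * bump y)]
    simp [bump_self]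
  map_star' a := by
    rw [← map_star, star_tmul, mk_tmul_eq y (star a) (star (bump y))]
    simp [bump_self]

/-- The canonical ⋆-homomorphism `A_{q(y)} → (q^* A)_y`. -/
def fiberHom (A : Type u) [NonUnitalCStarAlgebra A] [C0Algebra X A] (q : C(Y, X)) (y : Y) :
    Fiber X A (q y) →⋆ₙₐ[ℂ] Fiber Y (Pullback A q) y where
  toFun := Quotient.lift (toFiber A q y) (by
    intro a b hab
    have hab' : a - b ∈ idealAt X A (q y) := (Submodule.quotientRel_def _).mp hab
    rw [← sub_eq_zero, ← map_sub]
    exact (mk_tmul_bump_eq_zero_iff y _).mpr (Fiber.mk_eq_zero_iff.mpr hab'))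
  map_smul' c := by rintro ⟨a⟩; exact map_smul (toFiber A q y) c a
  map_zero' := map_zero (toFiber A q y)
  map_add' := by rintro ⟨a⟩ ⟨b⟩; exact map_add (toFiber A q y) a b
  map_mul' := by rintro ⟨a⟩ ⟨b⟩; exact map_mul (toFiber A q y) a b
  map_star' := by rintro ⟨a⟩; exact map_star (toFiber A q y) a

theorem fiberHom_mk (y : Y) (a : A) (F : C₀(Y, ℂ)) :
    F y • fiberHom A q y (Fiber.mk X (q y) a) = Fiber.mk Y y (tmul q a F) :=
  (mk_tmul_eq y a F).symm

theorem fiberHom_injective (y : Y) : Function.Injective (fiberHom A q y) := by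
  rw [injective_iff_map_eq_zero]
  rintro ⟨a⟩ h
  exact (mk_tmul_bump_eq_zero_iff y a).mp h

theorem fiberHom_surjective (y : Y) : Function.Surjective (fiberHom A q y) := by
  have hiso : Isometry (fiberHom A q y) :=
    NonUnitalStarAlgHom.isometry _ (fiberHom_injective y)
  have hcl : IsClosed (Set.range (fiberHom A q y)) := hiso.isClosedEmbedding.isClosed_range
  intro w
  obtain ⟨z, rfl⟩ := Fiber.mk_surjective w
  let S : Submodule ℂ (Pullback A q) :=
    { carrier := Fiber.mk Y y ⁻¹' Set.range (fiberHom A q y)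
      add_mem' := by
        rintro a b ⟨c, hc⟩ ⟨d, hd⟩
        exact ⟨c + d, by rw [map_add, map_add, hc, hd]⟩
      zero_mem' := ⟨0, by simp⟩
      smul_mem' := by
        rintro k a ⟨c, hc⟩
        exact ⟨k • c, by rw [map_smul, map_smul, hc]⟩ }
  refine induction_on S (hcl.preimage Fiber.continuous_mk) ?_ z
  intro a F
  exact ⟨F y • Fiber.mk X (q y) a, by rw [map_smul, fiberHom_mk]⟩

/-- The canonical isomorphism `(q^* A)_y = A_{q(y)}`, `(a ⊗ F)_y ↦ F(y) a_{q(y)}`. -/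
def fiberEquiv (A : Type u) [NonUnitalCStarAlgebra A] [C0Algebra X A] (q : C(Y, X)) (y : Y) :
    Fiber Y (Pullback A q) y ≃⋆ₐ[ℂ] Fiber X A (q y) :=
  (StarAlgEquiv.ofBijective (fiberHom A q y)
    ⟨fiberHom_injective y, fiberHom_surjective y⟩).symm

theorem fiberEquiv_mk_tmul (y : Y) (a : A) (F : C₀(Y, ℂ)) :
    fiberEquiv A q y (Fiber.mk Y y (tmul q a F)) = F y • Fiber.mk X (q y) a := by
  rw [← fiberHom_mk, ← map_smul]
  exact (StarAlgEquiv.ofBijective (fiberHom A q y)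
    ⟨fiberHom_injective y, fiberHom_surjective y⟩).symm_apply_apply
      (F y • Fiber.mk X (q y) a)

end Pullback

end Pullback

/-! ### The bundle `A^♯` -/

section Bundle

variable (X : Type*) [TopologicalSpace X] (A : Type*) [NonUnitalCStarAlgebra A] [C0Algebra X A]

/-- The total space `A^♯ = ⊔ A_x` of the C⋆-bundle of a `C₀(X)`-algebra. -/
structure TotalSpace where
  base : X
  val : Fiber X A base

variable {X A} in
/-- The basic open set `U(a, ε) = {b_x ∈ A_x : x ∈ U, ‖b_x - a_x‖ < ε}`. -/
def tube (U : Set X) (a : A) (ε : ℝ) : Set (TotalSpace X A) :=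
  {z | z.base ∈ U ∧ ‖z.val - Fiber.mk X z.base a‖ < ε}

/-- The topology of `A^♯`, with the sets `U(a, ε)` as basic open sets. -/
instance : TopologicalSpace (TotalSpace X A) :=
  TopologicalSpace.generateFrom
    {S | ∃ (U : Set X) (a : A) (ε : ℝ), IsOpen U ∧ 0 < ε ∧ S = tube U a ε}

end Bundle

/-! ### Isomorphisms of `C₀(Y)`-algebras -/

section C0Iso

variable (Y : Type*) [TopologicalSpace Y]
  (B : Type*) [NonUnitalCStarAlgebra B] [C0Algebra Y B]
  (C : Type*) [NonUnitalCStarAlgebra C] [C0Algebra Y C]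

/-- A `C₀(Y)`-isomorphism: a ⋆-isomorphism that is a `C₀(Y)`-module map. -/
structure C0Iso where
  toEquiv : B ≃⋆ₐ[ℂ] C
  map_act : ∀ (g : C₀(Y, ℂ)) (b : B), toEquiv (act g b) = act g (toEquiv b)

variable {Y B C}

namespace C0Iso

/-- The inverse of a `C₀(Y)`-isomorphism. -/
def symm (T : C0Iso Y B C) : C0Iso Y C B where
  toEquiv := T.toEquiv.symm
  map_act g c := by
    refine EquivLike.injective T.toEquiv ?_
    rw [T.map_act, StarAlgEquiv.apply_symm_apply, StarAlgEquiv.apply_symm_apply]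

theorem continuous (T : C0Iso Y B C) : Continuous T.toEquiv :=
  AddMonoidHomClass.continuous_of_bound T.toEquiv 1
    fun b ↦ by rw [one_mul]; exact NonUnitalStarAlgHom.norm_apply_le T.toEquiv b

theorem map_mem_idealAt (T : C0Iso Y B C) {y : Y} {b : B} (hb : b ∈ idealAt Y B y) :
    T.toEquiv b ∈ idealAt Y C y :=
  idealAt_induction _ (isClosed_idealAt y) T.toEquiv T.continuous (map_zero _) (map_add _)
    (fun c b h ↦ by rw [map_smul]; exact Submodule.smul_mem _ c h)
    (fun g b hg ↦ by rw [T.map_act]; exact act_mem_idealAt hg _) hb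

/-- The ⋆-homomorphism `B_y → C_y`, `b_y ↦ (T b)_y`. -/
def fiberHom (T : C0Iso Y B C) (y : Y) : Fiber Y B y →⋆ₙₐ[ℂ] Fiber Y C y where
  toFun := Quotient.lift (fun b ↦ Fiber.mk Y y (T.toEquiv b)) (by
    intro a b hab
    have hab' : a - b ∈ idealAt Y B y := (Submodule.quotientRel_def _).mp hab
    rw [← sub_eq_zero, ← map_sub, ← map_sub, Fiber.mk_eq_zero_iff]
    exact T.map_mem_idealAt hab')
  map_smul' c := by
    rintro ⟨a⟩
    change Fiber.mk Y y (T.toEquiv (c • a)) = c • Fiber.mk Y y (T.toEquiv a)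
    rw [map_smul, map_smul]
  map_zero' := by
    change Fiber.mk Y y (T.toEquiv 0) = 0
    rw [map_zero, map_zero]
  map_add' := by
    rintro ⟨a⟩ ⟨b⟩
    change Fiber.mk Y y (T.toEquiv (a + b))
      = Fiber.mk Y y (T.toEquiv a) + Fiber.mk Y y (T.toEquiv b)
    rw [map_add, map_add]
  map_mul' := by
    rintro ⟨a⟩ ⟨b⟩
    change Fiber.mk Y y (T.toEquiv (a * b))
      = Fiber.mk Y y (T.toEquiv a) * Fiber.mk Y y (T.toEquiv b)
    rw [map_mul, map_mul]
  map_star' := by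
    rintro ⟨a⟩
    change Fiber.mk Y y (T.toEquiv (star a)) = star (Fiber.mk Y y (T.toEquiv a))
    rw [map_star, map_star]

/-- The ⋆-isomorphism `T_y : B_y → C_y`, `b_y ↦ (T b)_y`, induced by a `C₀(Y)`-isomorphism. -/
def fiber (T : C0Iso Y B C) (y : Y) : Fiber Y B y ≃⋆ₐ[ℂ] Fiber Y C y :=
  StarAlgEquiv.ofBijective (T.fiberHom y) (Function.bijective_iff_has_inverse.mpr
    ⟨T.symm.fiberHom y,
      by
        rintro ⟨b⟩
        exact congrArg (Fiber.mk Y y) (T.toEquiv.symm_apply_apply b),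
      by
        rintro ⟨c⟩
        exact congrArg (Fiber.mk Y y) (T.toEquiv.apply_symm_apply c)⟩)

theorem fiber_mk (T : C0Iso Y B C) (y : Y) (b : B) :
    T.fiber y (Fiber.mk Y y b) = Fiber.mk Y y (T.toEquiv b) := rfl

end C0Iso

end C0Iso

/-! ### Groupoids -/

section Groupoids

/-- A groupoid `Γ` with unit space `X`: `mul γ γ' h` is the product `γγ'`, defined when
`s(γ) = r(γ')`. -/
class GroupoidOver (Γ : Type*) (X : outParam Type*) where
  /-- the source map `s` -/
  src : Γ → X
  /-- the range map `r` -/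
  rng : Γ → X
  /-- the inclusion of the unit space -/
  unit : X → Γ
  inv : Γ → Γ
  mul : (γ γ' : Γ) → src γ = rng γ' → Γ
  src_unit : ∀ x, src (unit x) = x
  rng_unit : ∀ x, rng (unit x) = x
  src_inv : ∀ γ, src (inv γ) = rng γ
  rng_inv : ∀ γ, rng (inv γ) = src γ
  src_mul : ∀ γ γ' h, src (mul γ γ' h) = src γ'
  rng_mul : ∀ γ γ' h, rng (mul γ γ' h) = rng γ
  mul_assoc : ∀ γ₁ γ₂ γ₃ (h₁ : src γ₁ = rng γ₂) (h₂ : src γ₂ = rng γ₃),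
    mul (mul γ₁ γ₂ h₁) γ₃ ((src_mul _ _ _).trans h₂)
      = mul γ₁ (mul γ₂ γ₃ h₂) (h₁.trans (rng_mul _ _ _).symm)
  unit_mul : ∀ γ, mul (unit (rng γ)) γ (src_unit _) = γ
  mul_unit : ∀ γ, mul γ (unit (src γ)) (rng_unit _).symm = γ
  inv_mul : ∀ γ, mul (inv γ) γ (src_inv γ) = unit (src γ)
  mul_inv : ∀ γ, mul γ (inv γ) (rng_inv γ).symm = unit (rng γ)

open GroupoidOver

/-- A homomorphism of groupoids with the same unit space `X` that is the identity on `X`. -/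
structure GroupoidHom (Γ Δ : Type*) {X : Type*} [GroupoidOver Γ X] [GroupoidOver Δ X] where
  toFun : Γ → Δ
  src_map : ∀ γ, src (toFun γ) = src γ
  rng_map : ∀ γ, rng (toFun γ) = rng γ
  map_mul : ∀ (γ γ' : Γ) (h : src γ = rng γ'), toFun (mul γ γ' h)
    = mul (toFun γ) (toFun γ') ((src_map γ).trans (h.trans (rng_map γ').symm))

/-- A topological groupoid: all structure maps are continuous. Thus the unit space `X` is
homeomorphic to its image in `Γ`. -/
class TopologicalGroupoid (Γ : Type*) {X : Type*} [TopologicalSpace Γ] [TopologicalSpace X]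
    [GroupoidOver Γ X] : Prop where
  continuous_src : Continuous (src : Γ → X)
  continuous_rng : Continuous (rng : Γ → X)
  continuous_unit : Continuous (unit : X → Γ)
  continuous_inv : Continuous (inv : Γ → Γ)
  continuous_mul : Continuous fun p : {p : Γ × Γ // src p.1 = rng p.2} ↦ mul p.1.1 p.1.2 p.2

variable (Γ : Type*) {X : Type*} [TopologicalSpace Γ] [TopologicalSpace X] [GroupoidOver Γ X]

section

variable [TopologicalGroupoid Γ]

/-- The source map as a continuous map. -/
def srcMap : C(Γ, X) := ⟨src, TopologicalGroupoid.continuous_src⟩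

/-- The range map as a continuous map. -/
def rngMap : C(Γ, X) := ⟨rng, TopologicalGroupoid.continuous_rng⟩

end

open MeasureTheory in
open scoped Classical in
/-- A left Haar system on `Γ`: Radon measures `λ^x` with support `r⁻¹(x)`, such that
`x ↦ ∫ f dλ^x` is continuous for `f ∈ C_c(Γ)`, and
`∫ f(γη) dλ^{s(γ)}(η) = ∫ f(η) dλ^{r(γ)}(η)`. -/
structure LeftHaarSystem [MeasurableSpace Γ] [BorelSpace Γ] where
  measure : X → Measure Γ
  regular : ∀ x, (measure x).Regular
  support_eq : ∀ x, (measure x).support = {γ | rng γ = x}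
  continuous_integral : ∀ f : Γ → ℂ, Continuous f → HasCompactSupport f →
    Continuous fun x ↦ ∫ γ, f γ ∂(measure x)
  left_invariant : ∀ f : Γ → ℂ, Continuous f → HasCompactSupport f → ∀ γ : Γ,
    ∫ η, (if h : src γ = rng η then f (mul γ η h) else 0) ∂(measure (src γ))
      = ∫ η, f η ∂(measure (rng γ))

end Groupoids

/-! ### The groupoid `Iso(A^♯)` -/

section FiberIso

variable (X : Type*) [TopologicalSpace X] (A : Type*) [NonUnitalCStarAlgebra A] [C0Algebra X A]

/-- An element of `Iso(A^♯)`: a ⋆-isomorphism from some fibre `A_x` onto some fibre `A_y`. -/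
structure FiberIso where
  source : X
  target : X
  iso : Fiber X A source ≃⋆ₐ[ℂ] Fiber X A target

variable {X A}

namespace FiberIso

/-- The identity map `A_x → A_y` for `x = y`. -/
def cast {x y : X} (h : x = y) : Fiber X A x ≃⋆ₐ[ℂ] Fiber X A y := h ▸ StarAlgEquiv.refl ℂ _

/-- The composition of maps `t ∘ t'`. -/
def comp (t t' : FiberIso X A) (h : t.source = t'.target) : FiberIso X A where
  source := t'.source
  target := t.target
  iso := (t'.iso.trans (cast h.symm)).trans t.iso

theorem comp_mk {a b c : X} (g : Fiber X A b ≃⋆ₐ[ℂ] Fiber X A c)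
    (f : Fiber X A a ≃⋆ₐ[ℂ] Fiber X A b) (h : b = b) :
    comp ⟨b, c, g⟩ ⟨a, b, f⟩ h = ⟨a, c, f.trans g⟩ :=
  congrArg (FiberIso.mk a c) (StarAlgEquiv.ext fun _ ↦ rfl)

theorem comp_congr {t t' u u' : FiberIso X A} (ht : t = t') (hu : u = u')
    (h : t.source = u.target) (h' : t'.source = u'.target) : comp t u h = comp t' u' h' := by
  subst ht hu; rfl

theorem trans_assoc {a b c d : X} (f : Fiber X A c ≃⋆ₐ[ℂ] Fiber X A d)
    (g : Fiber X A b ≃⋆ₐ[ℂ] Fiber X A c) (k : Fiber X A a ≃⋆ₐ[ℂ] Fiber X A b) :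
    k.trans (g.trans f) = (k.trans g).trans f := StarAlgEquiv.ext fun z ↦ by
  simp only [StarAlgEquiv.trans_apply]

theorem comp_assoc_mk {a b c d : X} (f : Fiber X A c ≃⋆ₐ[ℂ] Fiber X A d)
    (g : Fiber X A b ≃⋆ₐ[ℂ] Fiber X A c) (k : Fiber X A a ≃⋆ₐ[ℂ] Fiber X A b)
    (h₁ h₂ h₃ h₄) :
    comp (comp ⟨c, d, f⟩ ⟨b, c, g⟩ h₁) ⟨a, b, k⟩ h₂
      = comp ⟨c, d, f⟩ (comp ⟨b, c, g⟩ ⟨a, b, k⟩ h₃) h₄ := by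
  rw [comp_congr (comp_mk f g h₁) rfl h₂ rfl, comp_congr rfl (comp_mk g k h₃) h₄ rfl,
    comp_mk, comp_mk, trans_assoc]

theorem comp_assoc (t₁ t₂ t₃ : FiberIso X A) (h₁ : t₁.source = t₂.target)
    (h₂ : t₂.source = t₃.target) :
    comp (comp t₁ t₂ h₁) t₃ h₂ = comp t₁ (comp t₂ t₃ h₂) h₁ := by
  obtain ⟨a, b, f⟩ := t₁
  obtain ⟨c, d, g⟩ := t₂
  obtain ⟨e, k, l⟩ := t₃
  change a = d at h₁
  change c = k at h₂
  subst h₁ h₂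
  exact comp_assoc_mk f g l _ _ _ _

theorem refl_comp {a b : X} (f : Fiber X A a ≃⋆ₐ[ℂ] Fiber X A b) :
    comp ⟨b, b, StarAlgEquiv.refl ℂ _⟩ ⟨a, b, f⟩ rfl = ⟨a, b, f⟩ := by
  rw [comp_mk]
  exact congrArg (FiberIso.mk _ _) (StarAlgEquiv.ext fun _ ↦ rfl)

theorem comp_refl {a b : X} (f : Fiber X A a ≃⋆ₐ[ℂ] Fiber X A b) :
    comp ⟨a, b, f⟩ ⟨a, a, StarAlgEquiv.refl ℂ _⟩ rfl = ⟨a, b, f⟩ := by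
  rw [comp_mk]
  exact congrArg (FiberIso.mk _ _) (StarAlgEquiv.ext fun _ ↦ rfl)

theorem symm_comp {a b : X} (f : Fiber X A a ≃⋆ₐ[ℂ] Fiber X A b) :
    comp ⟨b, a, f.symm⟩ ⟨a, b, f⟩ rfl = ⟨a, a, StarAlgEquiv.refl ℂ _⟩ := by
  rw [comp_mk]
  exact congrArg (FiberIso.mk _ _) (StarAlgEquiv.ext fun z ↦ f.symm_apply_apply z)

theorem comp_symm {a b : X} (f : Fiber X A a ≃⋆ₐ[ℂ] Fiber X A b) :
    comp ⟨a, b, f⟩ ⟨b, a, f.symm⟩ rfl = ⟨b, b, StarAlgEquiv.refl ℂ _⟩ := by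
  rw [comp_mk]
  exact congrArg (FiberIso.mk _ _) (StarAlgEquiv.ext fun z ↦ f.apply_symm_apply z)

/-- `Iso(A^♯)` is a groupoid with unit space `X` under composition of maps. -/
instance : GroupoidOver (FiberIso X A) X where
  src := source
  rng := target
  unit x := ⟨x, x, StarAlgEquiv.refl ℂ _⟩
  inv t := ⟨t.target, t.source, t.iso.symm⟩
  mul := comp
  src_unit _ := rfl
  rng_unit _ := rfl
  src_inv _ := rfl
  rng_inv _ := rfl
  src_mul _ _ _ := rfl
  rng_mul _ _ _ := rfl
  mul_assoc := comp_assoc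
  unit_mul t := refl_comp t.iso
  mul_unit t := comp_refl t.iso
  inv_mul t := symm_comp t.iso
  mul_inv t := comp_symm t.iso

/-- For `t : A_x → A_y` in `Iso(A^♯)` and `a ∈ A`, the point `t(a_x)` of `A^♯`. -/
def onSection (t : FiberIso X A) (a : A) : TotalSpace X A :=
  ⟨t.target, t.iso (Fiber.mk X t.source a)⟩

end FiberIso

end FiberIso

/-! ### `Γ`-algebras -/

section GammaAlgebras

open GroupoidOver

variable (Γ : Type*) {X : Type*} [TopologicalSpace Γ] [LocallyCompactSpace Γ] [T2Space Γ]
  [TopologicalSpace X] [GroupoidOver Γ X] [TopologicalGroupoid Γ]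
  (A : Type*) [NonUnitalCStarAlgebra A] [C0Algebra X A]

variable {Γ A} in
/-- The isomorphism `α_γ : A_{s(γ)} = (s^* A)_γ → (r^* A)_γ = A_{r(γ)}` induced by a
`C₀(Γ)`-isomorphism `α : s^* A → r^* A`, as an element of `Iso(A^♯)`. -/
def inducedIso (α : C0Iso Γ (Pullback A (srcMap Γ)) (Pullback A (rngMap Γ))) (γ : Γ) :
    FiberIso X A where
  source := srcMap Γ γ
  target := rngMap Γ γ
  iso := ((Pullback.fiberEquiv A (srcMap Γ) γ).symm.trans (α.fiber γ)).trans
    (Pullback.fiberEquiv A (rngMap Γ) γ)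

/-- A `Γ`-algebra structure on a `C₀(X)`-algebra `A`: a `C₀(Γ)`-isomorphism `α : s^* A → r^* A`
with `α_{γγ'} = α_γ α_γ'` when `s(γ) = r(γ')`, and `α_{γ⁻¹} = (α_γ)⁻¹`. -/
structure GammaAlgebra where
  α : C0Iso Γ (Pullback A (srcMap Γ)) (Pullback A (rngMap Γ))
  map_mul : ∀ (γ γ' : Γ) (h : src γ = rng γ'),
    inducedIso α (mul γ γ' h) = mul (inducedIso α γ) (inducedIso α γ') h
  map_inv : ∀ γ : Γ, inducedIso α (inv γ) = inv (inducedIso α γ)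

/-- `A` is a `Γ`-algebra: it admits a `Γ`-algebra structure. -/
def IsGammaAlgebra : Prop := Nonempty (GammaAlgebra Γ A)

end GammaAlgebras

end GroupoidCStar

end

noncomputable section

namespace GroupoidCStar

/-! ### Functions vanishing at infinity -/

section ZeroAtInfty

variable {Y : Type*} [TopologicalSpace Y]

/-! A `C₀(Y)`-algebra is an algebra of sections of its fibres, and the theorem is a dictionary
between `C₀(Γ)`-isomorphisms `s^* A → r^* A` and families of fibre isomorphisms that respect such
sections.

Two facts about a `C₀(Y)`-algebra `B`, with `Y` locally compact Hausdorff, carry the argument.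
First, `y ↦ ‖b_y‖` is upper semicontinuous (`eventually_norm_mk_lt`) and vanishes at infinity
(`tendsto_norm_mk_cocompact`). Second, `B` embeds isometrically into the bounded product of its
fibres (`isometry_toFibers`), so its image is closed; with partitions of unity, every section that
vanishes at infinity and is locally approximated by elements of `B` is itself an element
(`exists_mk_eq`). Faithfulness of the embedding is proved without representation theory: if all
fibres of a self-adjoint element vanish, it is locally small, and taking powers of order `2 ^ k`
before patching makes the number of patches irrelevant.

From a structure `α` to continuity: near `γ₀` the point `a_{s(γ)}` is the fibre of `z = a ⊗ F` with
`F = 1` near `γ₀`, so `α_γ(a_{s(γ)})` is the fibre of the single element `α(z)` of `r^* A`, and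
elements of a pull-back give continuous maps into `A^♯` (`continuous_fiberEquiv_mk`).

From continuity to a structure: applying the fibre maps to an element of `s^* A` gives a section of
the fibres of `r^* A`. It is locally approximated by elements, because of continuity on the sections
given by `A`, and it vanishes at infinity because the fibre maps are isometric; hence it is an
element of `r^* A` (`exists_mk_eq_of_continuous`). The inverse family is treated in the same way: a
groupoid homomorphism preserves inverses and inversion on `Γ` is continuous. The algebraic
identities of a `Γ`-algebra structure are those of the homomorphism. -/

theorem norm_zeroAtInfty_le {f : C₀(Y, ℂ)} {c : ℝ} (hc : 0 ≤ c) (h : ∀ y, ‖f y‖ ≤ c) :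
    ‖f‖ ≤ c := by
  rw [← ZeroAtInftyContinuousMap.norm_toBCF_eq_norm]
  exact (BoundedContinuousFunction.norm_le hc).mpr h

theorem norm_zeroAtInfty_apply_le (f : C₀(Y, ℂ)) (y : Y) : ‖f y‖ ≤ ‖f‖ := by
  rw [← ZeroAtInftyContinuousMap.norm_toBCF_eq_norm]
  exact f.toBCF.norm_coe_le_norm y

/-- A compactly supported real function as an element of `C₀(Y)`. -/
def ofRealCompact (f : C(Y, ℝ)) (hf : HasCompactSupport f) : C₀(Y, ℂ) where
  toFun y := (f y : ℂ)
  continuous_toFun := by fun_prop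
  zero_at_infty' :=
    (hf.comp_left (g := fun r : ℝ ↦ (r : ℂ)) (by simp)).is_zero_at_infty

@[simp] theorem ofRealCompact_apply (f : C(Y, ℝ)) (hf : HasCompactSupport f) (y : Y) :
    ofRealCompact f hf y = (f y : ℂ) := rfl

/-- Urysohn's lemma in `C₀(Y)`: a real function of norm at most one that is one near a compact set
and has compact support in a given neighbourhood. -/
theorem exists_eq_one_on_isCompact [LocallyCompactSpace Y] [T2Space Y] {K : Set Y}
    (hK : IsCompact K) {U : Set Y} (hU : IsOpen U) (hKU : K ⊆ U) :
    ∃ (f : C₀(Y, ℂ)) (V L : Set Y), IsOpen V ∧ K ⊆ V ∧ IsCompact L ∧ (∀ y ∈ V, f y = 1) ∧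
      (∀ y ∉ U, f y = 0) ∧ (∀ y ∉ L, f y = 0) ∧ ‖f‖ ≤ 1 ∧ star f = f := by
  -- Urysohn is applied to a compact neighbourhood `k` of `K`, so that the function equals one on
  -- the open set `interior k` and not only on `K`.
  obtain ⟨k, hk, hKk, hkU⟩ := exists_compact_between hK hU hKU
  obtain ⟨f, hf1, hf0, hfc, hf⟩ := exists_continuous_one_zero_of_isCompact hk
    hU.isClosed_compl (Set.disjoint_compl_right_iff_subset.mpr hkU)
  refine ⟨ofRealCompact f hfc, interior k, tsupport f, isOpen_interior, hKk, hfc, fun y hy ↦ ?_,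
    fun y hy ↦ ?_, fun y hy ↦ ?_, norm_zeroAtInfty_le zero_le_one fun y ↦ ?_, ?_⟩
  · simp [hf1 (interior_subset hy)]
  · simp [hf0 hy]
  · simp [image_eq_zero_of_notMem_tsupport hy]
  · simp [abs_of_nonneg (hf y).1, (hf y).2]
  · ext y
    simp

/-- A partition of unity on a compact set subordinate to a family of open neighbourhoods. -/
theorem exists_partition [LocallyCompactSpace Y] [T2Space Y] {K : Set Y} (hK : IsCompact K)
    (U : Y → Set Y) (hU : ∀ y, IsOpen (U y)) (hyU : ∀ y, y ∈ U y) :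
    ∃ (n : ℕ) (p : Fin n → Y) (g : Fin n → C₀(Y, ℂ)) (ρ : Fin n → Y → ℝ),
      (∀ i y, g i y = ρ i y) ∧ (∀ i y, 0 ≤ ρ i y) ∧ (∀ y, ∑ i, ρ i y ≤ 1) ∧
      (∀ y ∈ K, ∑ i, ρ i y = 1) ∧ ∀ i, ∀ y ∉ U (p i), ρ i y = 0 := by
  obtain ⟨t, ht⟩ := hK.elim_finite_subcover U hU fun y _ ↦ Set.mem_iUnion.mpr ⟨y, hyU y⟩
  let p : Fin t.card → Y := fun i ↦ (t.equivFin.symm i : Y)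
  have hcov : K ⊆ ⋃ i, U (p i) := by
    intro y hy
    obtain ⟨z, hz, hyz⟩ := Set.mem_iUnion₂.mp (ht hy)
    exact Set.mem_iUnion.mpr ⟨t.equivFin ⟨z, hz⟩, by simpa [p] using hyz⟩
  obtain ⟨f, hsub, hc⟩ := PartitionOfUnity.exists_isSubordinate_of_locallyFinite_t2space hK
    (fun i ↦ U (p i)) (fun i ↦ hU _) (locallyFinite_of_finite _) hcov
  refine ⟨t.card, p, fun i ↦ ofRealCompact (f i) (hc i), fun i y ↦ f i y, fun i y ↦ rfl,
    fun i y ↦ f.nonneg i y, fun y ↦ ?_, fun y hy ↦ ?_, fun i y hy ↦ ?_⟩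
  · rw [← finsum_eq_sum_of_fintype]
    exact f.sum_le_one y
  · rw [← finsum_eq_sum_of_fintype]
    exact f.sum_eq_one hy
  · exact image_eq_zero_of_notMem_tsupport fun h ↦ hy (hsub i h)

end ZeroAtInfty

/-! ### Norms in the fibres -/

section FiberNorm

open Filter

variable {Y : Type*} [TopologicalSpace Y] {B : Type*} [NonUnitalCStarAlgebra B] [C0Algebra Y B]

theorem norm_act_le (f : C₀(Y, ℂ)) (b : B) : ‖act f b‖ ≤ ‖f‖ * ‖b‖ := by
  refine ((C0Algebra.θ (A := B) f).fst.le_opNorm b).trans ?_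
  rw [DoubleCentralizer.norm_fst]
  gcongr
  exact NonUnitalStarAlgHom.norm_apply_le _ f

theorem act_add_left (f g : C₀(Y, ℂ)) (b : B) : act (f + g) b = act f b + act g b := by
  simp [act]

theorem act_zero_left (b : B) : act (0 : C₀(Y, ℂ)) b = 0 := by simp [act]

theorem act_sub (f : C₀(Y, ℂ)) (a b : B) : act f (a - b) = act f a - act f b := map_sub _ _ _

theorem act_sum_left {ι : Type*} (s : Finset ι) (g : ι → C₀(Y, ℂ)) (b : B) :
    act (∑ i ∈ s, g i) b = ∑ i ∈ s, act (g i) b := by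
  classical
  induction s using Finset.induction_on with
  | empty => simp [act_zero_left]
  | insert i s hi h => rw [Finset.sum_insert hi, Finset.sum_insert hi, act_add_left, h]

theorem norm_mk_le (y : Y) (b : B) : ‖Fiber.mk Y y b‖ ≤ ‖b‖ := Fiber.norm_mkₗ_le b

/-- The elements whose fibre norms tend to zero along a filter form a closed subspace. -/
theorem tendsto_norm_mk_of_mem_closure {l : Filter Y} {s : Set B}
    (hs : ∀ b ∈ s, Tendsto (fun y ↦ ‖Fiber.mk Y y b‖) l (𝓝 0)) {b : B}
    (hb : b ∈ (Submodule.span ℂ s).topologicalClosure) :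
    Tendsto (fun y ↦ ‖Fiber.mk Y y b‖) l (𝓝 0) := by
  have hspan : ∀ b ∈ Submodule.span ℂ s, Tendsto (fun y ↦ ‖Fiber.mk Y y b‖) l (𝓝 0) := by
    intro b hb
    refine Submodule.span_induction hs ?_ ?_ ?_ hb
    · simp only [map_zero, norm_zero]
      exact tendsto_const_nhds
    · intro a b _ _ ha hb
      refine squeeze_zero (fun _ ↦ norm_nonneg _) (fun y ↦ ?_) (by simpa using ha.add hb)
      rw [map_add]
      exact norm_add_le _ _
    · intro c a _ ha
      simpa [norm_smul] using ha.const_mul ‖c‖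
  rw [Metric.tendsto_nhds]
  intro ε hε
  obtain ⟨c, hc, hbc⟩ := Metric.mem_closure_iff.mp hb (ε / 2) (half_pos hε)
  filter_upwards [Metric.tendsto_nhds.mp (hspan c hc) (ε / 2) (half_pos hε)] with y hy
  rw [dist_zero_right, norm_norm] at hy ⊢
  have h1 : Fiber.mk Y y b = Fiber.mk Y y (b - c) + Fiber.mk Y y c := by rw [← map_add]; simp
  have h2 := norm_mk_le y (b - c)
  rw [dist_eq_norm] at hbc
  have h3 := norm_add_le (Fiber.mk Y y (b - c)) (Fiber.mk Y y c)
  rw [h1]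
  linarith

/-- On a generator the fibre norm of `act f a` at `y'` is at most `‖f y'‖ * ‖a‖`, and `f` is
continuous with `f y = 0`. This is the source of upper semicontinuity. -/
theorem tendsto_norm_mk_nhds {y : Y} {b : B} (hb : b ∈ idealAt Y B y) :
    Tendsto (fun y' ↦ ‖Fiber.mk Y y' b‖) (𝓝 y) (𝓝 0) := by
  refine tendsto_norm_mk_of_mem_closure ?_ hb
  rintro _ ⟨f, a, hf, rfl⟩
  have h : Tendsto (fun y' ↦ ‖f y'‖ * ‖a‖) (𝓝 y) (𝓝 (‖f y‖ * ‖a‖)) :=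
    Continuous.tendsto (by fun_prop) y
  rw [hf, norm_zero, zero_mul] at h
  refine squeeze_zero (fun _ ↦ norm_nonneg _) (fun y' ↦ ?_) h
  rw [Fiber.mk_act, norm_smul]
  gcongr
  exact norm_mk_le _ _

/-- The fibre norms of an element vanish at infinity. -/
theorem tendsto_norm_mk_cocompact (b : B) :
    Tendsto (fun y ↦ ‖Fiber.mk Y y b‖) (cocompact Y) (𝓝 0) := by
  refine tendsto_norm_mk_of_mem_closure (s := {b : B | ∃ (f : C₀(Y, ℂ)) (a : B),
    (C0Algebra.θ (A := B) f).fst a = b}) ?_ (by rw [C0Algebra.nondegenerate]; trivial)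
  rintro _ ⟨f, a, rfl⟩
  have h : Tendsto (fun y ↦ ‖f y‖ * ‖a‖) (cocompact Y) (𝓝 (‖(0 : ℂ)‖ * ‖a‖)) :=
    (f.zero_at_infty'.norm).mul_const _
  rw [norm_zero, zero_mul] at h
  refine squeeze_zero (fun _ ↦ norm_nonneg _) (fun y ↦ ?_) h
  change ‖Fiber.mk Y y (act f a)‖ ≤ _
  rw [Fiber.mk_act, norm_smul]
  gcongr
  exact norm_mk_le _ _

/-- Upper semicontinuity of the fibre norms. -/
theorem eventually_norm_mk_lt {y : Y} {b : B} {ε : ℝ} (h : ‖Fiber.mk Y y b‖ < ε) :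
    ∀ᶠ y' in 𝓝 y, ‖Fiber.mk Y y' b‖ < ε := by
  -- The quotient norm is an infimum over lifts, so `b_y` has a lift `a` with `‖a‖ < ε`, which
  -- bounds `a` in every fibre at once. The difference `b - a` lies in `I_y B`, hence is small in
  -- the fibres near `y`.
  obtain ⟨a, ha, han⟩ := Fiber.norm_mkₗ_lt (Fiber.mk Y y b) (sub_pos.mpr h)
  have han' : ‖a‖ < ε := by linarith
  have hba : b - a ∈ idealAt Y B y := Fiber.mkₗ_eq_iff.mp ha.symm
  filter_upwards [Metric.tendsto_nhds.mp (tendsto_norm_mk_nhds hba) (ε - ‖a‖)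
    (sub_pos.mpr han')] with y' hy'
  rw [dist_zero_right, norm_norm] at hy'
  have h1 : Fiber.mk Y y' b = Fiber.mk Y y' (b - a) + Fiber.mk Y y' a := by rw [← map_add]; simp
  have h2 := norm_mk_le y' a
  have h3 := norm_add_le (Fiber.mk Y y' (b - a)) (Fiber.mk Y y' a)
  rw [h1]
  linarith

/-- An element of `I_y B` becomes small when multiplied by functions supported near `y`. -/
theorem exists_norm_act_le {y : Y} {b : B} (hb : b ∈ idealAt Y B y) {ε : ℝ} (hε : 0 < ε) :
    ∃ U : Set Y, IsOpen U ∧ y ∈ U ∧ ∀ h : C₀(Y, ℂ), ‖h‖ ≤ 1 → (∀ y' ∉ U, h y' = 0) →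
      ‖act h b‖ ≤ ε := by
  have hspan : ∀ b ∈ Submodule.span ℂ
      {b : B | ∃ (f : C₀(Y, ℂ)) (a : B), f y = 0 ∧ act f a = b}, ∀ ε : ℝ, 0 < ε →
      ∃ U : Set Y, IsOpen U ∧ y ∈ U ∧ ∀ h : C₀(Y, ℂ), ‖h‖ ≤ 1 → (∀ y' ∉ U, h y' = 0) →
        ‖act h b‖ ≤ ε := by
    intro b hb
    refine Submodule.span_induction ?_ ?_ ?_ ?_ hb
    · rintro _ ⟨f, a, hf, rfl⟩ ε hε
      -- For a generator, `U` is the set where `‖f‖` is below this bound; a contraction `h`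
      -- supported there makes `h * f` uniformly as small. Adding `1` keeps the denominator positive
      -- when `a = 0`.
      have hδ : 0 < ε / (‖a‖ + 1) := by positivity
      refine ⟨{y' | ‖f y'‖ < ε / (‖a‖ + 1)}, isOpen_lt (by fun_prop) continuous_const,
        by simpa [hf] using hδ, fun h hh hU ↦ ?_⟩
      rw [← act_mul_left]
      have hle : ‖h * f‖ ≤ ε / (‖a‖ + 1) := by
        refine norm_zeroAtInfty_le hδ.le fun y' ↦ ?_
        rw [ZeroAtInftyContinuousMap.mul_apply, norm_mul]
        by_cases hy' : ‖f y'‖ < ε / (‖a‖ + 1)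
        · calc ‖h y'‖ * ‖f y'‖ ≤ 1 * ‖f y'‖ := by
                gcongr
                exact (norm_zeroAtInfty_apply_le h y').trans hh
            _ ≤ _ := by rw [one_mul]; exact hy'.le
        · rw [hU y' hy', norm_zero, zero_mul]
          exact hδ.le
      calc _ ≤ ‖h * f‖ * ‖a‖ := norm_act_le _ _
        _ ≤ ε / (‖a‖ + 1) * (‖a‖ + 1) := by gcongr; linarith
        _ = ε := by field_simp
    · intro ε hε
      exact ⟨Set.univ, isOpen_univ, trivial, fun h _ _ ↦ by simpa [act] using hε.le⟩
    · intro a b _ _ ha hb ε hε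
      obtain ⟨U, hU, hyU, h1⟩ := ha (ε / 2) (half_pos hε)
      obtain ⟨V, hV, hyV, h2⟩ := hb (ε / 2) (half_pos hε)
      refine ⟨U ∩ V, hU.inter hV, ⟨hyU, hyV⟩, fun h hh hUV ↦ ?_⟩
      rw [act_add]
      have := norm_add_le (act h a) (act h b)
      have := h1 h hh fun y' hy' ↦ hUV y' fun h ↦ hy' h.1
      have := h2 h hh fun y' hy' ↦ hUV y' fun h ↦ hy' h.2
      linarith
    · intro c a _ ha ε hε
      obtain ⟨U, hU, hyU, h1⟩ := ha (ε / (‖c‖ + 1)) (by positivity)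
      refine ⟨U, hU, hyU, fun h hh hU ↦ ?_⟩
      rw [act_smul, norm_smul]
      calc _ ≤ (‖c‖ + 1) * (ε / (‖c‖ + 1)) := by
            gcongr
            · linarith
            · exact h1 h hh hU
        _ = ε := by field_simp
  obtain ⟨c, hc, hbc⟩ := Metric.mem_closure_iff.mp hb (ε / 2) (half_pos hε)
  obtain ⟨U, hU, hyU, h1⟩ := hspan c hc (ε / 2) (half_pos hε)
  refine ⟨U, hU, hyU, fun h hh hU ↦ ?_⟩
  have h2 : act h b = act h (b - c) + act h c := by rw [← act_add]; simp
  have h3 : ‖act h (b - c)‖ ≤ 1 * ‖b - c‖ := (norm_act_le _ _).trans (by gcongr)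
  have h4 := norm_add_le (act h (b - c)) (act h c)
  have h5 := h1 h hh hU
  rw [dist_eq_norm] at hbc
  rw [h2]
  linarith

/-- Every element is nearly supported on a compact set. -/
theorem exists_isCompact_norm_sub_act_le (b : B) {ε : ℝ} (hε : 0 < ε) :
    ∃ K : Set Y, IsCompact K ∧ ∀ g : C₀(Y, ℂ), ‖g‖ ≤ 1 → (∀ y ∈ K, g y = 1) →
      ‖b - act g b‖ ≤ ε := by
  have hspan : ∀ b ∈ Submodule.span ℂ
      {b : B | ∃ (f : C₀(Y, ℂ)) (a : B), (C0Algebra.θ (A := B) f).fst a = b}, ∀ ε : ℝ, 0 < ε →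
      ∃ K : Set Y, IsCompact K ∧ ∀ g : C₀(Y, ℂ), ‖g‖ ≤ 1 → (∀ y ∈ K, g y = 1) →
        ‖b - act g b‖ ≤ ε := by
    intro b hb
    refine Submodule.span_induction ?_ ?_ ?_ ?_ hb
    · rintro _ ⟨f, a, rfl⟩ ε hε
      have hδ : 0 < ε / (‖a‖ + 1) := by positivity
      -- The further factor `1 / 2` is needed because off `K` both `f` and `g * f` contribute to `f
      -- - g * f`; on `K` the difference vanishes.
      have hev := Metric.tendsto_nhds.mp f.zero_at_infty' (ε / (‖a‖ + 1) / 2) (half_pos hδ)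
      obtain ⟨K, hK, hKf⟩ := mem_cocompact.mp hev
      refine ⟨K, hK, fun g hg hgK ↦ ?_⟩
      change ‖act f a - act g (act f a)‖ ≤ ε
      rw [← act_mul_left, ← act_sub_left]
      have hle : ‖f - g * f‖ ≤ ε / (‖a‖ + 1) := by
        refine norm_zeroAtInfty_le hδ.le fun y ↦ ?_
        rw [ZeroAtInftyContinuousMap.sub_apply, ZeroAtInftyContinuousMap.mul_apply]
        by_cases hy : y ∈ K
        · rw [hgK y hy, one_mul, sub_self, norm_zero]
          exact hδ.le
        · have h1 : dist (f y) 0 < ε / (‖a‖ + 1) / 2 := hKf hy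
          rw [dist_zero_right] at h1
          have h2 : ‖g y * f y‖ ≤ 1 * ‖f y‖ := by
            rw [norm_mul]
            gcongr
            exact (norm_zeroAtInfty_apply_le g y).trans hg
          have h3 := norm_sub_le (f y) (g y * f y)
          linarith
      calc _ ≤ ‖f - g * f‖ * ‖a‖ := norm_act_le _ _
        _ ≤ ε / (‖a‖ + 1) * (‖a‖ + 1) := by gcongr; linarith
        _ = ε := by field_simp
    · intro ε hε
      exact ⟨∅, isCompact_empty, fun h _ _ ↦ by simpa [act] using hε.le⟩
    · intro a b _ _ ha hb ε hε
      obtain ⟨K, hK, h1⟩ := ha (ε / 2) (half_pos hε)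
      obtain ⟨L, hL, h2⟩ := hb (ε / 2) (half_pos hε)
      refine ⟨K ∪ L, hK.union hL, fun g hg hgK ↦ ?_⟩
      rw [act_add, add_sub_add_comm]
      have := norm_add_le (a - act g a) (b - act g b)
      have := h1 g hg fun y hy ↦ hgK y (Or.inl hy)
      have := h2 g hg fun y hy ↦ hgK y (Or.inr hy)
      linarith
    · intro c a _ ha ε hε
      obtain ⟨K, hK, h1⟩ := ha (ε / (‖c‖ + 1)) (by positivity)
      refine ⟨K, hK, fun g hg hgK ↦ ?_⟩
      rw [act_smul, ← smul_sub, norm_smul]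
      calc _ ≤ (‖c‖ + 1) * (ε / (‖c‖ + 1)) := by
            gcongr
            · linarith
            · exact h1 g hg hgK
        _ = ε := by field_simp
  have hb : b ∈ (Submodule.span ℂ {b : B | ∃ (f : C₀(Y, ℂ)) (a : B),
    (C0Algebra.θ (A := B) f).fst a = b}).topologicalClosure := by
    rw [C0Algebra.nondegenerate]; trivial
  obtain ⟨c, hc, hbc⟩ := Metric.mem_closure_iff.mp hb (ε / 3) (by positivity)
  obtain ⟨K, hK, h1⟩ := hspan c hc (ε / 3) (by positivity)
  refine ⟨K, hK, fun g hg hgK ↦ ?_⟩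
  -- Each of the three terms costs at most `ε / 3`: the approximation error twice, since `g` acts
  -- contractively, and the estimate for `c` once.
  have h2 : b - act g b = (b - c) + (c - act g c) - act g (b - c) := by
    rw [act_sub]; abel
  have h3 : ‖act g (b - c)‖ ≤ 1 * ‖b - c‖ := (norm_act_le _ _).trans (by gcongr)
  have h4 := norm_sub_le ((b - c) + (c - act g c)) (act g (b - c))
  have h5 := norm_add_le (b - c) (c - act g c)
  have h6 := h1 g hg hgK
  rw [dist_eq_norm] at hbc
  rw [h2]
  linarith

end FiberNorm

/-! ### Elements are determined by their fibres -/

section FiberFaithful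

open Filter

variable {Y : Type*} [TopologicalSpace Y] {B : Type*} [NonUnitalCStarAlgebra B] [C0Algebra Y B]

theorem isSelfAdjoint_iterate_sq {w : B} (hw : IsSelfAdjoint w) (k : ℕ) :
    IsSelfAdjoint ((fun x : B ↦ x * x)^[k] w) := by
  induction k with
  | zero => exact hw
  | succ k ih =>
    rw [Function.iterate_succ_apply', isSelfAdjoint_iff, star_mul, ih.star_eq]

/-- The C⋆-identity makes squaring exact on norms of self-adjoint elements, and squares stay
self-adjoint. -/
theorem norm_iterate_sq {w : B} (hw : IsSelfAdjoint w) (k : ℕ) :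
    ‖(fun x : B ↦ x * x)^[k] w‖ = ‖w‖ ^ 2 ^ k := by
  induction k with
  | zero => simp
  | succ k ih =>
    have h := CStarRing.norm_star_mul_self (x := (fun x : B ↦ x * x)^[k] w)
    rw [(isSelfAdjoint_iterate_sq hw k).star_eq] at h
    rw [Function.iterate_succ_apply', h, ih]
    ring

theorem norm_iterate_sq_le (w : B) (k : ℕ) : ‖(fun x : B ↦ x * x)^[k] w‖ ≤ ‖w‖ ^ 2 ^ k := by
  induction k with
  | zero => simp
  | succ k ih =>
    rw [Function.iterate_succ_apply', pow_succ, pow_mul, sq]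
    exact (norm_mul_le _ _).trans (mul_self_le_mul_self (norm_nonneg _) ih)

/-- The action is central, so the factor `g` can be moved onto either factor of a square, where the
previous stage replaces `w` by `act h w`; then it moves on to the other. A single cutoff `g` thus
localises an arbitrarily high power. -/
theorem act_iterate_sq {g h : C₀(Y, ℂ)} (hgh : g * h = g) (w : B) (k : ℕ) :
    act g ((fun x : B ↦ x * x)^[k] w) = act g ((fun x : B ↦ x * x)^[k] (act h w)) := by
  induction k with
  | zero => rw [Function.iterate_zero_apply, Function.iterate_zero_apply, ← act_mul_left, hgh]
  | succ k ih =>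
    rw [Function.iterate_succ_apply', Function.iterate_succ_apply', act_mul, ih, ← act_mul,
      ← mul_act, ih, mul_act]

/-- The constant `C` disappears on taking roots of order `2 ^ k`: if `a / b > 1`, its powers would
outgrow `C`. -/
theorem le_of_forall_pow_two_pow_le {a b C : ℝ} (hb : 0 < b)
    (h : ∀ k : ℕ, a ^ 2 ^ k ≤ C * b ^ 2 ^ k) : a ≤ b := by
  by_contra! hab
  have h1 : 1 < a / b := (one_lt_div hb).mpr hab
  have h2 : Tendsto (fun k : ℕ ↦ (a / b) ^ 2 ^ k) atTop atTop :=
    (tendsto_pow_atTop_atTop_of_one_lt h1).comp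
      (tendsto_pow_atTop_atTop_of_one_lt one_lt_two)
  obtain ⟨k, hk⟩ := (h2.eventually_gt_atTop C).exists
  rw [div_pow, lt_div_iff₀ (by positivity)] at hk
  exact absurd (h k) hk.not_ge

variable (Y B) in
/-- The ⋆-homomorphism of a `C₀(Y)`-algebra into the product of its fibres. -/
def toFibers : B →⋆ₙₐ[ℂ] lp (Fiber Y B) ∞ :=
  BalancedPair.prodHom (Fiber Y B) fun y ↦ Fiber.mk Y y

theorem toFibers_apply (b : B) (y : Y) : toFibers Y B b y = Fiber.mk Y y b := rfl

variable [LocallyCompactSpace Y] [T2Space Y]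

/-- Cut `z` off to `w = g z`, close to `z` and supported in a compact set `L`. Vanishing fibres
give, around each point, a function `h` equal to one there with `‖h w‖ ≤ ε`. Patching `w` itself by
a partition of unity with `n` members would only give `‖w‖ ≤ n ε`, with `n` depending on `ε`.
Patching the power of order `2 ^ k` gives `‖w‖ ^ 2 ^ k ≤ n * ε ^ 2 ^ k` for all `k`, hence `‖w‖ ≤
ε`. -/
theorem eq_zero_of_forall_mk_eq_zero_of_isSelfAdjoint {z : B} (hz : IsSelfAdjoint z)
    (h0 : ∀ y : Y, Fiber.mk Y y z = 0) : z = 0 := by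
  rw [← norm_le_zero_iff]
  refine le_of_forall_pos_le_add fun δ hδ ↦ ?_
  -- One `ε` pays for `z - w`, the other for `w`.
  obtain ⟨ε, hε, rfl⟩ : ∃ ε : ℝ, 0 < ε ∧ δ = ε + ε := ⟨δ / 2, half_pos hδ, by ring⟩
  obtain ⟨K, hK, hKz⟩ := exists_isCompact_norm_sub_act_le (Y := Y) z hε
  obtain ⟨g, V, L, -, hKV, hL, hgV, -, hgL, hg, hgs⟩ :=
    exists_eq_one_on_isCompact hK isOpen_univ (Set.subset_univ K)
  have hzw := hKz g hg fun y hy ↦ hgV y (hKV hy)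
  set w := act g z with hw
  have hws : IsSelfAdjoint w := by
    rw [isSelfAdjoint_iff, hw, star_act, hgs, hz.star_eq]
  have hloc : ∀ y : Y, ∃ (W : Set Y) (h : C₀(Y, ℂ)), IsOpen W ∧ y ∈ W ∧ (∀ y' ∈ W, h y' = 1) ∧
      ‖act h w‖ ≤ ε := by
    intro y
    obtain ⟨U, hU, hyU, hUz⟩ := exists_norm_act_le (Fiber.mk_eq_zero_iff.mp (h0 y)) hε
    obtain ⟨h, W, -, hW, hyW, -, hW1, hU0, -, hh, -⟩ :=
      exists_eq_one_on_isCompact isCompact_singleton hU (Set.singleton_subset_iff.mpr hyU)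
    refine ⟨W, h, hW, hyW rfl, hW1, ?_⟩
    rw [hw, ← act_mul_left, mul_comm, act_mul_left]
    calc _ ≤ ‖g‖ * ‖act h z‖ := norm_act_le _ _
      _ ≤ 1 * ε := mul_le_mul hg (hUz h hh hU0) (norm_nonneg _) zero_le_one
      _ = ε := one_mul _
  choose W h hW hyW hW1 hWε using hloc
  obtain ⟨n, p, u, ρ, huρ, hρ0, hρ1, hρL, hρW⟩ := exists_partition hL W hW hyW
  have hu1 : ∀ i, ‖u i‖ ≤ 1 := fun i ↦ norm_zeroAtInfty_le zero_le_one fun y ↦ by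
    rw [huρ, Complex.norm_real, Real.norm_of_nonneg (hρ0 i y)]
    exact (Finset.single_le_sum (fun j _ ↦ hρ0 j y) (Finset.mem_univ i)).trans (hρ1 y)
  -- `u i` vanishes off `W (p i)`, where `h (p i)` is one; this is the absorption hypothesis of
  -- `act_iterate_sq`.
  have huh : ∀ i, u i * h (p i) = u i := by
    intro i
    ext y
    rw [ZeroAtInftyContinuousMap.mul_apply]
    by_cases hy : y ∈ W (p i)
    · rw [hW1 _ y hy, mul_one]
    · rw [huρ, hρW i y hy]; simp
  -- The partition sums to one on `L`, and `g` vanishes off `L`. Hence the sum fixes `w` and all its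
  -- powers.
  have hsum : (∑ i, u i) * g = g := by
    ext y
    rw [ZeroAtInftyContinuousMap.mul_apply]
    by_cases hy : y ∈ L
    · have h1 : (∑ i, u i) y = ∑ i, u i y :=
        map_sum (⟨⟨fun f : C₀(Y, ℂ) ↦ f y, rfl⟩, fun _ _ ↦ rfl⟩ : C₀(Y, ℂ) →+ ℂ) _ _
      have h2 : ∑ i, u i y = ((∑ i, ρ i y : ℝ) : ℂ) := by
        rw [Complex.ofReal_sum]
        exact Finset.sum_congr rfl fun i _ ↦ huρ i y
      rw [h1, h2, hρL y hy, Complex.ofReal_one, one_mul]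
    · rw [hgL y hy, mul_zero]
  have hwsum : act (∑ i, u i) w = w := by rw [hw, ← act_mul_left, hsum]
  have hpow : ∀ k : ℕ, ‖w‖ ^ 2 ^ k ≤ n * ε ^ 2 ^ k := by
    intro k
    have hk : act (∑ i, u i) ((fun x : B ↦ x * x)^[k] w) = (fun x : B ↦ x * x)^[k] w := by
      induction k with
      | zero => exact hwsum
      | succ k ih => rw [Function.iterate_succ_apply', act_mul, ih]
    rw [← norm_iterate_sq hws, ← hk, act_sum_left]
    calc _ ≤ ∑ i, ‖act (u i) ((fun x : B ↦ x * x)^[k] w)‖ := norm_sum_le _ _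
      _ ≤ ∑ _i : Fin n, ε ^ 2 ^ k := by
        refine Finset.sum_le_sum fun i _ ↦ ?_
        rw [act_iterate_sq (huh i)]
        calc _ ≤ ‖u i‖ * ‖(fun x : B ↦ x * x)^[k] (act (h (p i)) w)‖ := norm_act_le _ _
          _ ≤ 1 * ‖act (h (p i)) w‖ ^ 2 ^ k :=
            mul_le_mul (hu1 i) (norm_iterate_sq_le _ _) (norm_nonneg _) zero_le_one
          _ ≤ ε ^ 2 ^ k := by
            rw [one_mul]
            exact pow_le_pow_left₀ (norm_nonneg _) (hWε _) _
      _ = n * ε ^ 2 ^ k := by simp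
  have hwε : ‖w‖ ≤ ε := le_of_forall_pow_two_pow_le hε hpow
  have h3 := norm_add_le (z - w) w
  rw [sub_add_cancel] at h3
  linarith

/-- An element of a `C₀(Y)`-algebra is zero if all its fibres are. -/
theorem eq_zero_of_forall_mk_eq_zero {z : B} (h0 : ∀ y : Y, Fiber.mk Y y z = 0) : z = 0 := by
  rw [← CStarRing.star_mul_self_eq_zero_iff]
  exact eq_zero_of_forall_mk_eq_zero_of_isSelfAdjoint (Y := Y) (IsSelfAdjoint.star_mul_self z)
    fun y ↦ by rw [map_mul, h0, mul_zero]

theorem ext_mk {z w : B} (h : ∀ y : Y, Fiber.mk Y y z = Fiber.mk Y y w) : z = w := by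
  rw [← sub_eq_zero]
  exact eq_zero_of_forall_mk_eq_zero (Y := Y) fun y ↦ by rw [map_sub, h, sub_self]

/-- An injective ⋆-homomorphism of C⋆-algebras is isometric. The use is that the range in the
product of the fibres is closed. -/
theorem isometry_toFibers : Isometry (toFibers Y B) :=
  NonUnitalStarAlgHom.isometry _ fun z w h ↦ ext_mk (Y := Y) fun y ↦ by
    rw [← toFibers_apply, h, toFibers_apply]

/-- A section of the fibres that vanishes at infinity and is locally a uniform limit of elements
comes from an element. -/
theorem exists_mk_eq {σ : ∀ y : Y, Fiber Y B y}
    (hloc : ∀ (y : Y) (ε : ℝ), 0 < ε → ∃ b : B, ∀ᶠ y' in 𝓝 y, ‖Fiber.mk Y y' b - σ y'‖ < ε)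
    (hinf : Tendsto (fun y ↦ ‖σ y‖) (cocompact Y) (𝓝 0)) :
    ∃ b : B, ∀ y, Fiber.mk Y y b = σ y := by
  have happrox : ∀ ε : ℝ, 0 < ε → ∃ b : B, ∀ y, ‖Fiber.mk Y y b - σ y‖ ≤ ε := by
    intro ε hε
    obtain ⟨K, hK, hKσ⟩ := mem_cocompact.mp (Metric.tendsto_nhds.mp hinf ε hε)
    have hloc' : ∀ y : Y, ∃ (b : B) (U : Set Y), IsOpen U ∧ y ∈ U ∧
        ∀ y' ∈ U, ‖Fiber.mk Y y' b - σ y'‖ < ε := by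
      intro y
      obtain ⟨b, hb⟩ := hloc y ε hε
      obtain ⟨U, hU, hUo, hyU⟩ := eventually_nhds_iff.mp hb
      exact ⟨b, U, hUo, hyU, hU⟩
    choose b U hU hyU hUb using hloc'
    obtain ⟨n, p, g, ρ, hgρ, hρ0, hρ1, hρK, hρU⟩ := exists_partition hK U hU hyU
    refine ⟨∑ i, act (g i) (b (p i)), fun y ↦ ?_⟩
    -- The error splits into an average of local errors, with total weight `∑ i, ρ i y`, and a
    -- defect of weight `1 - ∑ i, ρ i y`. The defect vanishes on `K`, and off `K` the section itself
    -- is below `ε`; so the total is at most `ε`.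
    have h1 : Fiber.mk Y y (∑ i, act (g i) (b (p i))) - σ y
        = ∑ i, (ρ i y : ℂ) • (Fiber.mk Y y (b (p i)) - σ y)
          - ((1 - ∑ i, ρ i y : ℝ) : ℂ) • σ y := by
      rw [map_sum]
      simp only [Fiber.mk_act, hgρ, smul_sub, Finset.sum_sub_distrib, Complex.ofReal_sub,
        Complex.ofReal_sum, sub_smul, Finset.sum_smul, Complex.ofReal_one, one_smul]
      abel
    have h2 : ‖∑ i, (ρ i y : ℂ) • (Fiber.mk Y y (b (p i)) - σ y)‖ ≤ (∑ i, ρ i y) * ε := by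
      rw [Finset.sum_mul]
      refine (norm_sum_le _ _).trans (Finset.sum_le_sum fun i _ ↦ ?_)
      rw [norm_smul, Complex.norm_real, Real.norm_of_nonneg (hρ0 i y)]
      by_cases hy : y ∈ U (p i)
      · exact mul_le_mul_of_nonneg_left (hUb _ y hy).le (hρ0 i y)
      · rw [hρU i y hy, zero_mul, zero_mul]
    have h3 : ‖((1 - ∑ i, ρ i y : ℝ) : ℂ) • σ y‖ ≤ (1 - ∑ i, ρ i y) * ε := by
      rw [norm_smul, Complex.norm_real, Real.norm_of_nonneg (sub_nonneg.mpr (hρ1 y))]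
      by_cases hy : y ∈ K
      · rw [hρK y hy, sub_self, zero_mul, zero_mul]
      · have h4 : dist ‖σ y‖ 0 < ε := hKσ hy
        rw [dist_zero_right, norm_norm] at h4
        exact mul_le_mul_of_nonneg_left h4.le (sub_nonneg.mpr (hρ1 y))
    rw [h1]
    refine (norm_sub_le _ _).trans ((add_le_add h2 h3).trans_eq (by ring))
  -- Any one uniform approximation shows that `σ` is bounded, hence a point of the bounded product.
  obtain ⟨b₀, hb₀⟩ := happrox 1 one_pos
  let s : lp (Fiber Y B) ∞ := ⟨σ, memℓp_infty ⟨‖b₀‖ + 1, by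
    rintro _ ⟨y, rfl⟩
    have h1 := norm_sub_le (Fiber.mk Y y b₀) (Fiber.mk Y y b₀ - σ y)
    rw [sub_sub_cancel] at h1
    exact h1.trans (add_le_add (norm_mk_le _ _) (hb₀ y))⟩⟩
  have hs : s ∈ closure (Set.range (toFibers Y B)) := by
    rw [Metric.mem_closure_iff]
    intro ε hε
    obtain ⟨b, hb⟩ := happrox (ε / 2) (half_pos hε)
    refine ⟨_, ⟨b, rfl⟩, ?_⟩
    rw [dist_comm, dist_eq_norm]
    exact (lp.norm_le_of_forall_le (half_pos hε).le hb).trans_lt (half_lt_self hε)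
  rw [isometry_toFibers.isClosedEmbedding.isClosed_range.closure_eq] at hs
  obtain ⟨b, hb⟩ := hs
  exact ⟨b, fun y ↦ by rw [← toFibers_apply, hb]⟩

end FiberFaithful

/-! ### Isomorphisms from families of fibre isomorphisms -/

section OfFibers

variable {Y : Type*} [TopologicalSpace Y] [LocallyCompactSpace Y] [T2Space Y]
  {B : Type*} [NonUnitalCStarAlgebra B] [C0Algebra Y B]
  {C : Type*} [NonUnitalCStarAlgebra C] [C0Algebra Y C]

/-- Fibre isomorphisms that, together with their inverses, carry the sections given by elements to
sections given by elements, come from a `C₀(Y)`-isomorphism. -/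
theorem C0Iso.exists_of_fibers (χ : ∀ y, Fiber Y B y ≃⋆ₐ[ℂ] Fiber Y C y)
    (h : ∀ b : B, ∃ c : C, ∀ y, Fiber.mk Y y c = χ y (Fiber.mk Y y b))
    (h' : ∀ c : C, ∃ b : B, ∀ y, Fiber.mk Y y b = (χ y).symm (Fiber.mk Y y c)) :
    ∃ T : C0Iso Y B C, ∀ y b, Fiber.mk Y y (T.toEquiv b) = χ y (Fiber.mk Y y b) := by
  choose T hT using h
  let T' : B →⋆ₙₐ[ℂ] C :=
    { toFun := T
      map_smul' := fun c b ↦ ext_mk (Y := Y) fun y ↦ by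
        rw [hT, map_smul, map_smul, MonoidHom.id_apply, map_smul, hT]
      map_zero' := ext_mk (Y := Y) fun y ↦ by rw [hT, map_zero, map_zero, map_zero]
      map_add' := fun a b ↦ ext_mk (Y := Y) fun y ↦ by
        rw [hT, map_add, map_add, map_add, hT, hT]
      map_mul' := fun a b ↦ ext_mk (Y := Y) fun y ↦ by
        rw [hT, map_mul, map_mul, map_mul, hT, hT]
      map_star' := fun b ↦ ext_mk (Y := Y) fun y ↦ by
        rw [hT, map_star, map_star, map_star, hT] }
  have hbij : Function.Bijective T' := by
    refine ⟨fun a b hab ↦ ext_mk (Y := Y) fun y ↦ ?_, fun c ↦ ?_⟩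
    · refine EquivLike.injective (χ y) ?_
      rw [← hT, ← hT]
      exact congrArg (Fiber.mk Y y) hab
    · obtain ⟨b, hb⟩ := h' c
      refine ⟨b, ext_mk (Y := Y) fun y ↦ ?_⟩
      change Fiber.mk Y y (T b) = _
      rw [hT, hb, StarAlgEquiv.apply_symm_apply]
  refine ⟨⟨StarAlgEquiv.ofBijective T' hbij, fun g b ↦ ext_mk (Y := Y) fun y ↦ ?_⟩,
    fun y b ↦ hT b y⟩
  change Fiber.mk Y y (T (act g b)) = Fiber.mk Y y (act g (T b))
  rw [hT, Fiber.mk_act, Fiber.mk_act, hT, map_smul]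

end OfFibers

/-! ### Continuous sections of pull-backs -/

section PullbackSections

open Filter

universe u v

variable {X : Type*} [TopologicalSpace X] {A : Type u} [NonUnitalCStarAlgebra A] [C0Algebra X A]

theorem norm_starAlgEquiv {B C : Type*} [NonUnitalCStarAlgebra B] [NonUnitalCStarAlgebra C]
    (e : B ≃⋆ₐ[ℂ] C) (b : B) : ‖e b‖ = ‖b‖ :=
  NonUnitalStarAlgHom.norm_map e (EquivLike.injective e) b

theorem isOpen_tube {U : Set X} (hU : IsOpen U) (a : A) {ε : ℝ} (hε : 0 < ε) :
    IsOpen (tube U a ε) :=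
  TopologicalSpace.isOpen_generateFrom_of_mem ⟨U, a, ε, hU, hε, rfl⟩

variable {Y : Type v} [TopologicalSpace Y] [LocallyCompactSpace Y] [T2Space Y]

/-- An element of `q^* A` whose image in the fibre `A_{q(y)}` is `a_{q(y)}` for `y` near `y₀`. -/
theorem exists_fiberEquiv_mk_eq (q : C(Y, X)) (a : A) (y₀ : Y) :
    ∃ z : Pullback A q, ∀ᶠ y in 𝓝 y₀,
      Pullback.fiberEquiv A q y (Fiber.mk Y y z) = Fiber.mk X (q y) a := by
  obtain ⟨F, V, -, hV, hyV, -, hF, -⟩ := exists_eq_one_on_isCompact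
    (isCompact_singleton (x := y₀)) isOpen_univ (Set.subset_univ _)
  refine ⟨Pullback.tmul q a F, eventually_of_mem (hV.mem_nhds (hyV rfl)) fun y hy ↦ ?_⟩
  rw [Pullback.fiberEquiv_mk_tmul, hF y hy, one_smul]

/-- The elements of `q^* A` give continuous maps into `A^♯`. -/
theorem continuous_fiberEquiv_mk (q : C(Y, X)) (z : Pullback A q) :
    Continuous fun y ↦
      (⟨q y, Pullback.fiberEquiv A q y (Fiber.mk Y y z)⟩ : TotalSpace X A) := by
  refine continuous_generateFrom_iff.mpr ?_
  rintro _ ⟨U, a, ε, hU, hε, rfl⟩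
  refine isOpen_iff_mem_nhds.mpr ?_
  rintro y₀ ⟨hy₀, hlt⟩
  -- Near `y₀` the fibres of `w` are those of `a`, so the distance to the centre of the tube is the
  -- fibre norm of the single element `z - w`, to which upper semicontinuity applies.
  obtain ⟨w, hw⟩ := exists_fiberEquiv_mk_eq q a y₀
  have hdist : ∀ y, Pullback.fiberEquiv A q y (Fiber.mk Y y w) = Fiber.mk X (q y) a →
      ‖Fiber.mk Y y (z - w)‖
        = ‖Pullback.fiberEquiv A q y (Fiber.mk Y y z) - Fiber.mk X (q y) a‖ := fun y hy ↦ by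
    rw [← hy, ← map_sub, ← map_sub, norm_starAlgEquiv]
  have hlt' : ‖Fiber.mk Y y₀ (z - w)‖ < ε := (hdist y₀ hw.self_of_nhds).trans_lt hlt
  filter_upwards [hw, eventually_norm_mk_lt hlt', (hU.preimage q.continuous).mem_nhds hy₀]
    with y h1 h2 h3
  exact ⟨h3, (hdist y h1).symm.trans_lt h2⟩

variable {p q : C(Y, X)}

/-- A continuous family of fibre isomorphisms carries elements of `p^* A` to elements of
`q^* A`. -/
theorem exists_mk_eq_of_continuous
    (ψ : ∀ y, Fiber X A (p y) ≃⋆ₐ[ℂ] Fiber X A (q y))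
    (hψ : ∀ a : A, Continuous fun y ↦ (⟨q y, ψ y (Fiber.mk X (p y) a)⟩ : TotalSpace X A))
    (z : Pullback A p) : ∃ w : Pullback A q, ∀ y, Fiber.mk Y y w
      = (Pullback.fiberEquiv A q y).symm (ψ y (Pullback.fiberEquiv A p y (Fiber.mk Y y z))) := by
  refine exists_mk_eq (fun y₀ ε hε ↦ ?_) ?_
  · obtain ⟨a, ha⟩ := Fiber.mk_surjective (Pullback.fiberEquiv A p y₀ (Fiber.mk Y y₀ z))
    obtain ⟨b, hb⟩ := Fiber.mk_surjective (ψ y₀ (Fiber.mk X (p y₀) a))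
    obtain ⟨v, hv⟩ := exists_fiberEquiv_mk_eq p a y₀
    obtain ⟨w, hw⟩ := exists_fiberEquiv_mk_eq q b y₀
    have hzv : ‖Fiber.mk Y y₀ (z - v)‖ < ε / 2 := by
      rw [← norm_starAlgEquiv (Pullback.fiberEquiv A p y₀), map_sub, map_sub, hv.self_of_nhds, ha,
        sub_self, norm_zero]
      exact half_pos hε
    have htube := ((isOpen_tube isOpen_univ b (half_pos hε)).preimage (hψ a)).mem_nhds
      (x := y₀) ⟨trivial, by simpa [hb] using half_pos hε⟩
    refine ⟨w, ?_⟩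
    filter_upwards [hv, hw, eventually_norm_mk_lt hzv, htube] with y hvy hwy hzvy hy
    have h1 : ‖ψ y (Fiber.mk X (p y) a) - Fiber.mk X (q y) b‖ < ε / 2 := hy.2
    have h2 : ‖ψ y (Pullback.fiberEquiv A p y (Fiber.mk Y y z)) - ψ y (Fiber.mk X (p y) a)‖
        < ε / 2 := by
      rw [← hvy, ← map_sub, ← map_sub, ← map_sub, norm_starAlgEquiv, norm_starAlgEquiv]
      exact hzvy
    rw [← norm_starAlgEquiv (Pullback.fiberEquiv A q y), map_sub, hwy,
      StarAlgEquiv.apply_symm_apply, norm_sub_rev]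
    have h3 := norm_add_le
      (ψ y (Pullback.fiberEquiv A p y (Fiber.mk Y y z)) - ψ y (Fiber.mk X (p y) a))
      (ψ y (Fiber.mk X (p y) a) - Fiber.mk X (q y) b)
    rw [sub_add_sub_cancel] at h3
    linarith
  -- All the fibre isomorphisms are isometric, so the section has the same fibre norms as `z`.
  · simp only [norm_starAlgEquiv]
    exact tendsto_norm_mk_cocompact z

/-- A family of fibre isomorphisms that is continuous together with its inverse comes from a
`C₀(Y)`-isomorphism of the pull-backs. -/
theorem exists_c0Iso_of_continuous
    (ψ : ∀ y, Fiber X A (p y) ≃⋆ₐ[ℂ] Fiber X A (q y))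
    (hψ : ∀ a : A, Continuous fun y ↦ (⟨q y, ψ y (Fiber.mk X (p y) a)⟩ : TotalSpace X A))
    (hψ' : ∀ a : A,
      Continuous fun y ↦ (⟨p y, (ψ y).symm (Fiber.mk X (q y) a)⟩ : TotalSpace X A)) :
    ∃ T : C0Iso Y (Pullback A p) (Pullback A q), ∀ y z,
      Pullback.fiberEquiv A q y (Fiber.mk Y y (T.toEquiv z))
        = ψ y (Pullback.fiberEquiv A p y (Fiber.mk Y y z)) := by
  obtain ⟨T, hT⟩ := C0Iso.exists_of_fibers
    (fun y ↦ ((Pullback.fiberEquiv A p y).trans (ψ y)).trans (Pullback.fiberEquiv A q y).symm)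
    (exists_mk_eq_of_continuous ψ hψ)
    (exists_mk_eq_of_continuous (fun y ↦ (ψ y).symm) hψ')
  refine ⟨T, fun y z ↦ ?_⟩
  rw [hT]
  exact StarAlgEquiv.apply_symm_apply _ _

end PullbackSections

/-! ### Groupoid homomorphisms -/

section GroupoidHoms

namespace GroupoidOver

variable {Γ X : Type*} [GroupoidOver Γ X]

/-- The composability proof is an argument of `mul`, so replacing a factor requires replacing the
proof as well. -/
theorem mul_congr {γ γ' δ δ' : Γ} (h₁ : γ = γ') (h₂ : δ = δ') (h : src γ = rng δ)
    (h' : src γ' = rng δ') : mul γ δ h = mul γ' δ' h' := by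
  subst h₁ h₂; rfl

theorem unit_mul' {x : X} {γ : Γ} (hx : x = rng γ) :
    mul (unit x) γ ((src_unit x).trans hx) = γ := by
  subst hx; exact unit_mul γ

/-- An idempotent in a groupoid is a unit: cancel one factor with `inv e`. -/
theorem eq_unit_of_mul_self {e : Γ} (h : src e = rng e) (he : mul e e h = e) :
    e = unit (src e) :=
  calc e = mul (unit (src e)) e ((src_unit _).trans h) := (unit_mul' h).symm
    _ = mul (mul (inv e) e (src_inv e)) e ((src_mul _ _ _).trans h) :=
      mul_congr (inv_mul e).symm rfl _ _
    _ = mul (inv e) (mul e e h) ((src_inv e).trans (rng_mul _ _ _).symm) := mul_assoc _ _ _ _ _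
    _ = mul (inv e) e (src_inv e) := mul_congr rfl he _ _
    _ = unit (src e) := inv_mul e

theorem eq_inv_of_mul_eq_unit {u v : Γ} (h : src u = rng v) (huv : mul u v h = unit (src v)) :
    u = inv v :=
  calc u = mul u (unit (src u)) (rng_unit _).symm := (mul_unit u).symm
    _ = mul u (mul v (inv v) (rng_inv v).symm) (h.trans (rng_mul _ _ _).symm) :=
      mul_congr rfl ((congrArg unit h).trans (mul_inv v).symm) _ _
    _ = mul (mul u v h) (inv v) ((src_mul _ _ _).trans (rng_inv v).symm) :=
      (mul_assoc _ _ _ _ _).symm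
    _ = mul (unit (src v)) (inv v) ((src_unit _).trans (rng_inv v).symm) :=
      mul_congr huv rfl _ _
    _ = inv v := unit_mul' (rng_inv v).symm

end GroupoidOver

open GroupoidOver

namespace GroupoidHom

variable {Γ Δ X : Type*} [GroupoidOver Γ X] [GroupoidOver Δ X] (φ : GroupoidHom Γ Δ)

/-- Preservation of units is not a field of `GroupoidHom`: it follows because the image of a unit is
idempotent and its source is known. -/
theorem map_unit (x : X) : φ.toFun (unit x) = unit x := by
  have h : src (unit x : Γ) = rng (unit x : Γ) := (src_unit x).trans (rng_unit x).symm
  have hm : mul (unit x : Γ) (unit x) h = unit x := unit_mul' (rng_unit x).symm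
  have he := eq_unit_of_mul_self (e := φ.toFun (unit x)) _
    ((φ.map_mul _ _ h).symm.trans (congrArg φ.toFun hm))
  rwa [φ.src_map, src_unit] at he

theorem map_inv (γ : Γ) : φ.toFun (inv γ) = inv (φ.toFun γ) := by
  refine eq_inv_of_mul_eq_unit _ ((φ.map_mul _ _ (src_inv γ)).symm.trans ?_)
  rw [inv_mul, map_unit, φ.src_map]

end GroupoidHom

/-- A homomorphism preserves sources and ranges only up to a propositional equality. This moves the
fibre isomorphism to the prescribed fibres, so that `φ` becomes a family indexed by `srcMap` and
`rngMap`. -/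
theorem FiberIso.exists_eq_mk {X : Type*} [TopologicalSpace X] {A : Type*}
    [NonUnitalCStarAlgebra A] [C0Algebra X A] (t : FiberIso X A) {x y : X}
    (hx : t.source = x) (hy : t.target = y) :
    ∃ ψ : Fiber X A x ≃⋆ₐ[ℂ] Fiber X A y, t = ⟨x, y, ψ⟩ := by
  subst hx hy
  exact ⟨t.iso, rfl⟩

variable {Γ X A : Type*} [TopologicalSpace Γ] [LocallyCompactSpace Γ] [T2Space Γ]
  [TopologicalSpace X] [GroupoidOver Γ X] [TopologicalGroupoid Γ]
  [NonUnitalCStarAlgebra A] [C0Algebra X A]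

/-- The fibre isomorphisms induced by a `C₀(Γ)`-isomorphism `s^* A → r^* A` form a continuous
family. -/
theorem continuous_inducedIso_onSection
    (α : C0Iso Γ (Pullback A (srcMap Γ)) (Pullback A (rngMap Γ))) (a : A) :
    Continuous fun γ : Γ ↦ (inducedIso α γ).onSection a := by
  refine continuous_iff_continuousAt.mpr fun γ₀ ↦ ?_
  -- Near `γ₀` the map in question agrees with the one given by `α.toEquiv z`, and continuity at
  -- `γ₀` only depends on a neighbourhood.
  obtain ⟨z, hz⟩ := exists_fiberEquiv_mk_eq (srcMap Γ) a γ₀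
  refine (continuous_fiberEquiv_mk (rngMap Γ) (α.toEquiv z)).continuousAt.congr ?_
  filter_upwards [hz] with γ hγ
  refine congrArg (TotalSpace.mk (rngMap Γ γ)) ?_
  change _ = Pullback.fiberEquiv A (rngMap Γ) γ
    (α.fiber γ ((Pullback.fiberEquiv A (srcMap Γ) γ).symm (Fiber.mk X (srcMap Γ γ) a)))
  rw [← hγ, StarAlgEquiv.symm_apply_apply, C0Iso.fiber_mk]

/-- A continuous homomorphism into `Iso(A^♯)` is induced by a `Γ`-algebra structure. -/
theorem exists_gammaAlgebra_of_continuous (φ : GroupoidHom Γ (FiberIso X A))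
    (hφ : ∀ a : A, Continuous fun γ : Γ ↦ (φ.toFun γ).onSection a) :
    ∃ G : GammaAlgebra Γ A, ∀ γ : Γ, inducedIso G.α γ = φ.toFun γ := by
  choose ψ hψ using fun γ : Γ ↦ (φ.toFun γ).exists_eq_mk (x := srcMap Γ γ) (y := rngMap Γ γ)
    (φ.src_map γ) (φ.rng_map γ)
  -- The inverse family is the original one composed with inversion, and is therefore continuous
  -- too; this is what makes the map of pull-backs bijective.
  have hinv : ∀ γ, φ.toFun (inv γ) = ⟨rngMap Γ γ, srcMap Γ γ, (ψ γ).symm⟩ := fun γ ↦ by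
    rw [φ.map_inv, hψ]; rfl
  obtain ⟨T, hT⟩ := exists_c0Iso_of_continuous ψ
    (fun a ↦ (hφ a).congr fun γ ↦ by rw [hψ]; rfl)
    (fun a ↦ ((hφ a).comp TopologicalGroupoid.continuous_inv).congr fun γ ↦ by
      rw [Function.comp_apply, hinv]; rfl)
  have hind : ∀ γ, inducedIso T γ = φ.toFun γ := by
    intro γ
    rw [hψ]
    refine congrArg (FiberIso.mk _ _) (StarAlgEquiv.ext fun x ↦ ?_)
    obtain ⟨z, hz⟩ := Fiber.mk_surjective ((Pullback.fiberEquiv A (srcMap Γ) γ).symm x)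
    change Pullback.fiberEquiv A (rngMap Γ) γ
      (T.fiber γ ((Pullback.fiberEquiv A (srcMap Γ) γ).symm x)) = _
    rw [← hz, C0Iso.fiber_mk, hT, hz, StarAlgEquiv.apply_symm_apply]
  refine ⟨⟨T, fun γ γ' h ↦ ?_, fun γ ↦ ?_⟩, hind⟩
  · rw [hind, φ.map_mul γ γ' h]
    exact mul_congr (hind γ).symm (hind γ').symm _ _
  · rw [hind, hind, φ.map_inv]

/-- The homomorphism into `Iso(A^♯)` given by a `Γ`-algebra structure. -/
def GammaAlgebra.toGroupoidHom (G : GammaAlgebra Γ A) : GroupoidHom Γ (FiberIso X A) where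
  toFun := inducedIso G.α
  src_map _ := rfl
  rng_map _ := rfl
  map_mul := G.map_mul

end GroupoidHoms

end GroupoidCStar

end

theorem mainTheorem5 {Γ X A : Type*}
    [TopologicalSpace Γ] [T2Space Γ] [LocallyCompactSpace Γ] [SecondCountableTopology Γ]
    [TopologicalSpace X] [GroupoidCStar.GroupoidOver Γ X] [GroupoidCStar.TopologicalGroupoid Γ]
    [MeasurableSpace Γ] [BorelSpace Γ] (_haar : GroupoidCStar.LeftHaarSystem Γ)
    [NonUnitalCStarAlgebra A] [TopologicalSpace.SeparableSpace A] [GroupoidCStar.C0Algebra X A] :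
    (GroupoidCStar.IsGammaAlgebra Γ A ↔
      ∃ φ : GroupoidCStar.GroupoidHom Γ (GroupoidCStar.FiberIso X A),
        ∀ a : A, Continuous fun γ : Γ ↦ (φ.toFun γ).onSection a) ∧
    (∀ φ : GroupoidCStar.GroupoidHom Γ (GroupoidCStar.FiberIso X A),
      (∀ a : A, Continuous fun γ : Γ ↦ (φ.toFun γ).onSection a) ↔
        ∃ G : GroupoidCStar.GammaAlgebra Γ A,
          ∀ γ : Γ, GroupoidCStar.inducedIso G.α γ = φ.toFun γ) := by
  refine ⟨⟨fun ⟨G⟩ ↦ ⟨G.toGroupoidHom, GroupoidCStar.continuous_inducedIso_onSection G.α⟩,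
    fun ⟨φ, hφ⟩ ↦ ⟨(GroupoidCStar.exists_gammaAlgebra_of_continuous φ hφ).choose⟩⟩,
    fun φ ↦ ⟨GroupoidCStar.exists_gammaAlgebra_of_continuous φ, ?_⟩⟩
  rintro ⟨G, hG⟩ a
  simpa only [hG] using GroupoidCStar.continuous_inducedIso_onSection G.α a
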